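/- Let $\mathcal G=(V,E)$ be a finite connected simple graph with no vertex of degree $1$, with positive edge weights $\mathbf x=(x_e)_{e\in E}$. A rooted loop of length $n\ge 1$ is a sequence of directed edges $\vec\omega=(\vec\omega_1,\dots,\vec\omega_{n+1})$ with $\vec\omega_{n+1}=\vec\omega_1$ such that, for $1\le i\le n$, $\vec\omega_{i+1}$ starts at the end of $\vec\omega_i$ and is not its reversal; its weight is $x(\vec\omega)=\prod_{i=1}^n\sqrt{x_{\omega_i}x_{\omega_{i+1}}}$ and its multiplicity $m_{\vec\omega}$ is the largest $m$ such that $\vec\omega$ is the $m$-fold concatenation of a rooted loop with itself. A loop $\ell$ is a class of rooted loops up to cyclic shift and reversal, $\mu(\ell)=x(\ell)/m_\ell$, and $$Z_{\mathcal L}=\sum_{L}\prod_{\ell\in L}\frac{\mu(\ell)^{\#\ell}}{(\#\ell)!}\in[0,\infty],$$ where the sum is over all finite multisets $L$ of loops, the product is over the distinct loops in $L$, and $\#\ell$ is the number of occurrences of $\ell$ in $L$. Given edge weights $c_e\ge0$ and killing rates $k_v\ge0$ with $\lambda_v=\sum_{e\ni v}c_e+k_v>0$, let $\bar P$ be the induced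 transition matrix on $V\cup\{\Delta\}$: $p_{v,u}=c_{\{v,u\}}/\lambda_v$ if $\{v,u\}\in E$ and $p_{v,u}=0$ for all other $v,u\in V$, $p_{v,\Delta}=k_v/\lambda_v$, $p_{\Delta,\Delta}=1$. The partition function of the associated discrete Gaussian free field (defined when the Green's function of $\bar P$, i.e. the expected number of visits to $u$ of the chain started at $v$, is finite for all $v,u\in V$) is $$Z^{GFF}_{\bar P}=\int_{\mathbb R^V}\exp\Big(-\tfrac12\sum_{\{v,u\}\in E}c_{\{v,u\}}(\varphi_v-\varphi_u)^2-\tfrac12\sum_{v\in V}k_v\varphi_v^2\Big)\,d\varphi .$$ Theorem. Assume $\|\mathbf x\|_\infty<1$ and $\sum_{e\ni v}\frac{x_e}{1+x_e}\le 1$ for all $v\in V$. Put $\lambda^*_v=1+\sum_{e\ni v}\frac{x_e^2}{1-x_e^2}$, and $P^*_{v,u}=\frac1{\lambda^*_v}\frac{x_e}{1-x_e^2}$ if $e=\{v,u\}\in E$, $P^*_{v,u}=0$ otherwise. Then $P^*$ is a $\lambda^*$-symmetric (that is, $\lambda^*_vP^*_{v,u}=\lambda^*_uP^*_{u,v}$)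 sub-Markovian transition matrix on $V$ (nonnegative entries, row sums at most $1$). Its Markovian extension $\bar P^*$ to $V\cup\{\Delta\}$, in which the missing mass of each row goes to the absorbing state $\Delta$, is induced, together with $\lambda^*$, by exactly one choice of edge weights $c_e\ge0$ and killing rates $k_v\ge0$. Moreover, if $Z_{\mathcal L}<\infty$, then the Green's function of $\bar P^*$ is finite on $V\times V$ and $$Z_{\mathcal L}=(2\pi)^{-|V|/2}\prod_{e\in E}(1-x_e^2)^{-1/2}\,Z^{GFF}_{\bar P^*},$$ where $Z^{GFF}_{\bar P^*}$ is formed with these $c$ and $k$. -/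

import Mathlib

open scoped ENNReal BigOperators

noncomputable section

namespace NBLoop

variable {V : Type*}

/-- An admissible (non-backtracking) step between directed edges: the second edge starts where
the first one ends and is not the reversal of the first one. -/
def Step {G : SimpleGraph V} (d d' : G.Dart) : Prop :=
  d.snd = d'.fst ∧ d' ≠ d.symm

/-- A rooted loop `(ω₁, …, ωₙ, ωₙ₊₁ = ω₁)` of length `n ≥ 1`: a non-backtracking walk on directed
edges which starts and ends at the same directed edge.  The closed walk is recorded by its
`n`-periodic extension: `dart i` is the directed edge `ω_{i+1}`, so the root is `dart 0`. -/
@[ext]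
structure RootedLoop (G : SimpleGraph V) where
  len : ℕ
  len_pos : 0 < len
  dart : ℤ → G.Dart
  periodic : ∀ i, dart (i + len) = dart i
  step : ∀ i, Step (dart i) (dart (i + 1))

namespace RootedLoop

variable {G : SimpleGraph V}

/-- Cyclic shift: move the root by `k` places. -/
def shift (ω : RootedLoop G) (k : ℤ) : RootedLoop G where
  len := ω.len
  len_pos := ω.len_pos
  dart i := ω.dart (i + k)
  periodic i := by rw [← ω.periodic (i + k)]; congr 1; ring
  step i := by
    have h := ω.step (i + k)
    rwa [show i + k + 1 = i + 1 + k by ring] at h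

/-- Reversal `ω⁻¹ = (-ωₙ₊₁, …, -ω₁)`. -/
def reverse (ω : RootedLoop G) : RootedLoop G where
  len := ω.len
  len_pos := ω.len_pos
  dart i := (ω.dart (-i)).symm
  periodic i := by
    rw [← ω.periodic (-(i + (ω.len : ℤ)))]; congr 2; ring
  step i := by
    have h := ω.step (-(i + 1))
    rw [show -(i + 1) + 1 = -i by ring] at h
    refine ⟨h.1.symm, fun hc => h.2 ?_⟩
    rw [SimpleGraph.Dart.symm_symm] at hc
    exact hc.symm

/-- The concatenation of `m ≥ 1` copies of a rooted loop. -/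
def repeated (ω : RootedLoop G) (m : ℕ) (hm : 0 < m) : RootedLoop G where
  len := m * ω.len
  len_pos := Nat.mul_pos hm ω.len_pos
  dart := ω.dart
  periodic i := by
    have h : Function.Periodic ω.dart (ω.len : ℤ) := ω.periodic
    have := h.nat_mul m i
    simpa using this
  step := ω.step

/-- The multiplicity: the largest `m` such that `ω` is the `m`-fold concatenation of some rooted
loop with itself (the set is nonempty and bounded by the length of `ω`). -/
def multiplicity (ω : RootedLoop G) : ℕ :=
  sSup {m | ∃ (ω' : RootedLoop G) (hm : 0 < m), ω = ω'.repeated m hm}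

/-- The weight of the walk, `∏ᵢ √(x_{ωᵢ} x_{ωᵢ₊₁})` over its `n` steps. -/
def weight (x : G.edgeSet → ℝ) (ω : RootedLoop G) : ℝ :=
  ∏ i ∈ Finset.range ω.len,
    Real.sqrt (x ⟨(ω.dart i).edge, (ω.dart i).edge_mem⟩ *
      x ⟨(ω.dart (i + 1)).edge, (ω.dart (i + 1)).edge_mem⟩)

/-- Two rooted loops are equivalent if one is obtained from the other by a cyclic shift, possibly
followed by reversal. -/
def Equivalent (ω ω' : RootedLoop G) : Prop :=
  ∃ k : ℤ, ω' = ω.shift k ∨ ω' = (ω.shift k).reverse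

theorem shift_zero (ω : RootedLoop G) : ω.shift 0 = ω := by
  ext <;> simp [shift]

theorem shift_shift (ω : RootedLoop G) (j k : ℤ) : (ω.shift j).shift k = ω.shift (k + j) := by
  ext1
  · rfl
  · funext i; simp [shift, add_assoc]

theorem reverse_reverse (ω : RootedLoop G) : ω.reverse.reverse = ω := by
  ext1
  · rfl
  · funext i; simp [reverse]

theorem reverse_shift (ω : RootedLoop G) (k : ℤ) : ω.reverse.shift k = (ω.shift (-k)).reverse := by
  ext1
  · rfl
  · funext i; simp only [reverse, shift]; congr 2; ring

theorem equivalent_equivalence : Equivalence (Equivalent (G := G)) where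
  refl ω := ⟨0, Or.inl ω.shift_zero.symm⟩
  symm := by
    rintro ω ω' ⟨k, rfl | rfl⟩
    · exact ⟨-k, Or.inl (by rw [shift_shift]; simp [shift_zero])⟩
    · exact ⟨k, Or.inr (by rw [reverse_shift, reverse_reverse, shift_shift]; simp [shift_zero])⟩
  trans := by
    rintro ω ω' ω'' ⟨k, rfl | rfl⟩ ⟨j, rfl | rfl⟩
    · exact ⟨j + k, Or.inl (shift_shift _ _ _)⟩
    · exact ⟨j + k, Or.inr (by rw [shift_shift])⟩
    · exact ⟨-j + k, Or.inr (by rw [reverse_shift, shift_shift])⟩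
    · exact ⟨-j + k, Or.inl (by rw [reverse_shift, reverse_reverse, shift_shift])⟩

theorem reverse_repeated (ω : RootedLoop G) (m : ℕ) (hm : 0 < m) :
    (ω.repeated m hm).reverse = ω.reverse.repeated m hm := rfl

theorem multiplicity_shift (ω : RootedLoop G) (k : ℤ) :
    (ω.shift k).multiplicity = ω.multiplicity := by
  unfold multiplicity
  congr 1
  ext m
  constructor
  · rintro ⟨ω', hm, h⟩
    refine ⟨ω'.shift (-k), hm, ?_⟩
    have h2 : (ω.shift k).shift (-k) = (ω'.repeated m hm).shift (-k) := by rw [h]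
    rw [shift_shift, neg_add_cancel, shift_zero] at h2
    exact h2
  · rintro ⟨ω', hm, h⟩
    exact ⟨ω'.shift k, hm, by rw [h]; rfl⟩

theorem multiplicity_reverse (ω : RootedLoop G) : ω.reverse.multiplicity = ω.multiplicity := by
  unfold multiplicity
  congr 1
  ext m
  constructor
  · rintro ⟨ω', hm, h⟩
    exact ⟨ω'.reverse, hm, by rw [← reverse_repeated, ← h, reverse_reverse]⟩
  · rintro ⟨ω', hm, h⟩
    exact ⟨ω'.reverse, hm, by rw [← reverse_repeated, ← h]⟩

theorem prod_range_shift (f : ℤ → ℝ) (n : ℕ) (hf : ∀ i, f (i + n) = f i) (k : ℤ) :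
    ∏ i ∈ Finset.range n, f (i + k) = ∏ i ∈ Finset.range n, f i := by
  have key : ∀ j : ℤ,
      ∏ i ∈ Finset.range n, f (i + (j + 1)) = ∏ i ∈ Finset.range n, f (i + j) := by
    intro j
    rcases n with _ | n
    · simp
    · rw [Finset.prod_range_succ, Finset.prod_range_succ']
      congr 1
      · refine Finset.prod_congr rfl fun i _ => ?_
        congr 1; push_cast; ring
      · rw [← hf ((0 : ℕ) + j)]; congr 1; push_cast; ring
  induction k using Int.induction_on with
  | zero => simp
  | succ j ih => rw [key, ih]
  | pred j ih => rw [← ih, ← key (-(j : ℤ) - 1)]; simp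

theorem weight_shift (x : G.edgeSet → ℝ) (ω : RootedLoop G) (k : ℤ) :
    (ω.shift k).weight x = ω.weight x := by
  have h := prod_range_shift
    (fun i => Real.sqrt (x ⟨(ω.dart i).edge, (ω.dart i).edge_mem⟩ *
      x ⟨(ω.dart (i + 1)).edge, (ω.dart (i + 1)).edge_mem⟩)) ω.len
    (fun i => by
      have h1 := ω.periodic i
      have h2 := ω.periodic (i + 1)
      rw [show i + 1 + (ω.len : ℤ) = i + ω.len + 1 by ring] at h2
      simp only [h1, h2]) k
  unfold weight
  rw [← h]
  refine Finset.prod_congr rfl fun i _ => ?_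
  simp only [shift, show (i : ℤ) + 1 + k = i + k + 1 by ring]

theorem weight_reverse (x : G.edgeSet → ℝ) (ω : RootedLoop G) :
    ω.reverse.weight x = ω.weight x := by
  unfold weight
  rw [← Finset.prod_range_reflect]
  have hp : ∀ i : ℤ, ω.dart (i - ω.len) = ω.dart i := fun i => by
    rw [← ω.periodic (i - ω.len)]; simp
  refine Finset.prod_congr rfl fun i hi => ?_
  have hi' : i + 1 ≤ ω.len := Finset.mem_range.1 hi
  have hc : ((ω.len - 1 - i : ℕ) : ℤ) = ω.len - 1 - i := by omega
  have h1 : ω.dart (-(((ω.len - 1 - i : ℕ) : ℤ) + 1)) = ω.dart i := by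
    rw [← hp i, hc]; congr 1; ring
  have h2 : ω.dart (-((ω.len - 1 - i : ℕ) : ℤ)) = ω.dart (i + 1) := by
    rw [← hp (i + 1), hc]; congr 1; ring
  simp only [reverse, SimpleGraph.Dart.edge_symm, h1, h2]
  rw [mul_comm]

theorem Equivalent.weight_eq (x : G.edgeSet → ℝ) {ω ω' : RootedLoop G} (h : ω.Equivalent ω') :
    ω.weight x = ω'.weight x := by
  obtain ⟨k, rfl | rfl⟩ := h
  · rw [weight_shift]
  · rw [weight_reverse, weight_shift]

theorem Equivalent.multiplicity_eq {ω ω' : RootedLoop G} (h : ω.Equivalent ω') :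
    ω.multiplicity = ω'.multiplicity := by
  obtain ⟨k, rfl | rfl⟩ := h
  · rw [multiplicity_shift]
  · rw [multiplicity_reverse, multiplicity_shift]

instance setoid (G : SimpleGraph V) : Setoid (RootedLoop G) where
  r := Equivalent
  iseqv := equivalent_equivalence

end RootedLoop

/-- Loops: rooted loops up to cyclic shift and reversal. -/
def Loop (G : SimpleGraph V) : Type _ := Quotient (RootedLoop.setoid G)

/-- The loop measure `μ(ℓ) = x(ℓ) / m_ℓ`. -/
def loopMeasure {G : SimpleGraph V} (x : G.edgeSet → ℝ) : Loop G → ℝ :=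
  Quotient.lift (fun ω : RootedLoop G => ω.weight x / ω.multiplicity) fun _ _ h => by
    have h' : RootedLoop.Equivalent _ _ := h
    simp only [h'.weight_eq x, h'.multiplicity_eq]

open Classical in
/-- The weight `w(L) = ∏_{ℓ ∈ L} μ(ℓ)^{#ℓ} / (#ℓ)!` of a loop configuration, a finite multiset of
loops; the product is over the distinct loops in `L`. -/
def configWeight {G : SimpleGraph V} (x : G.edgeSet → ℝ) (L : Multiset (Loop G)) : ℝ :=
  ∏ ℓ ∈ L.toFinset, loopMeasure x ℓ ^ L.count ℓ / (L.count ℓ).factorial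

/-- The partition function `Z = ∑_L w(L)` of the non-backtracking loop soup, as an element of
`[0, ∞]` (the weights are nonnegative when `x` is). -/
def loopPartition {G : SimpleGraph V} (x : G.edgeSet → ℝ) : ℝ≥0∞ :=
  ∑' L : Multiset (Loop G), ENNReal.ofReal (configWeight x L)

/-! ### Sub-Markovian matrices, Green's function, Gaussian free field -/

/-- A sub-Markovian transition matrix: nonnegative entries, row sums at most one. -/
def IsSubMarkovian [Fintype V] (P : Matrix V V ℝ) : Prop :=
  (∀ v u, 0 ≤ P v u) ∧ ∀ v, ∑ u, P v u ≤ 1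

/-- `lam`-symmetry of a transition matrix. -/
def IsSymmetricWrt (lam : V → ℝ) (P : Matrix V V ℝ) : Prop :=
  ∀ v u, lam v * P v u = lam u * P u v

/-- The Markovian extension of `P` to `V ∪ {Δ}`: the missing mass goes to the absorbing cemetery
state `Δ`, which is `none`. -/
def markovExtension [Fintype V] (P : Matrix V V ℝ) : Matrix (Option V) (Option V) ℝ
  | some v, some u => P v u
  | some v, none => 1 - ∑ u, P v u
  | none, some _ => 0
  | none, none => 1

/-- Green's function of a Markov chain with transition matrix `Q` on `V ∪ {Δ}`: the expected number
of visits to `u` of the chain started at `v`, i.e. the sum over `n ≥ 0` of the probabilities of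
being at `u` at time `n`. -/
def green [Fintype V] [DecidableEq V] (Q : Matrix (Option V) (Option V) ℝ) (v u : V) : ℝ≥0∞ :=
  ∑' n : ℕ, ENNReal.ofReal ((Q ^ n) (some v) (some u))

/-- Nonnegative edge weights `c` and nonnegative killing rates `k` on a graph. -/
structure KilledNetwork (G : SimpleGraph V) where
  conductance : G.edgeSet → ℝ
  killing : V → ℝ
  conductance_nonneg : ∀ e, 0 ≤ conductance e
  killing_nonneg : ∀ v, 0 ≤ killing v

namespace KilledNetwork

variable [Fintype V] [DecidableEq V] {G : SimpleGraph V} [DecidableRel G.Adj]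

/-- `λ_v = ∑_{e ∋ v} c_e + k_v`. -/
def rate (N : KilledNetwork G) (v : V) : ℝ :=
  (∑ e : G.edgeSet with v ∈ e.1, N.conductance e) + N.killing v

/-- The transition matrix on `V ∪ {Δ}` induced by the network: `p_{v,u} = c_{vu} / λ_v` along
edges, `p_{v,Δ} = k_v / λ_v`, and `Δ` is absorbing. -/
def transition (N : KilledNetwork G) : Matrix (Option V) (Option V) ℝ
  | some v, some u => if h : G.Adj v u then N.conductance ⟨s(v, u), h⟩ / N.rate v else 0
  | some v, none => N.killing v / N.rate v
  | none, some _ => 0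
  | none, none => 1

/-- The Hamiltonian of the discrete Gaussian free field,
`½ ∑_{{v,u} ∈ E} c_{vu} (φ_v - φ_u)² + ½ ∑_v k_v φ_v²`. -/
def hamiltonian (N : KilledNetwork G) (φ : V → ℝ) : ℝ :=
  1 / 2 * (∑ e : G.edgeSet, N.conductance e *
      Sym2.lift ⟨fun v u => (φ v - φ u) ^ 2, fun v u => by ring⟩ e.1) +
    1 / 2 * ∑ v, N.killing v * φ v ^ 2

/-- The partition function of the discrete Gaussian free field: the integral over `ℝ^V` of
`exp (-H)` with respect to Lebesgue measure, as an element of `[0, ∞]`. -/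
def gffPartition (N : KilledNetwork G) : ℝ≥0∞ :=
  ∫⁻ φ : V → ℝ, ENNReal.ofReal (Real.exp (-N.hamiltonian φ))

end KilledNetwork

section Star

variable [Fintype V] [DecidableEq V] {G : SimpleGraph V} [DecidableRel G.Adj]

/-- `λ*_v = 1 + ∑_{e ∋ v} x_e² / (1 - x_e²)`. -/
def lamStar (x : G.edgeSet → ℝ) (v : V) : ℝ :=
  1 + ∑ e : G.edgeSet with v ∈ e.1, x e ^ 2 / (1 - x e ^ 2)

/-- The matrix `P*`. -/
def PStar (x : G.edgeSet → ℝ) : Matrix V V ℝ := fun v u =>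
  if h : G.Adj v u then
    1 / lamStar x v * (x ⟨s(v, u), h⟩ / (1 - x ⟨s(v, u), h⟩ ^ 2))
  else 0

end Star

end NBLoop

end

/-! Write `Λ` for `stepMatrix x`, indexed by directed edges. Both partition functions turn out to be
powers `-1/2` of determinants. A Poissonian sum over multisets is an exponential, so a finite `Z`
equals `exp` of the total mass of the loop measure (`tsum_multisetWeight_eq_exp`). A loop of length
`n` and multiplicity `m` has exactly `2n/m` rooted representatives, because a non-backtracking loop
is never a cyclic shift of its own reversal (`card_class_mul_multiplicity`). The mass is therefore
the sum over rooted loops of weight over `2n`, that is `½ ∑ tr(Λⁿ)/n`, and `Z = det(1 - Λ)^(-1/2)`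
(`loopPartition_eq_det`). The weighted Ihara–Bass formula `det_one_sub_stepMatrix_eq` reduces this
to vertices: `det(1 - Λ) = ∏ (1 - x_e²) · det L`, where `L = diag(λ*) (1 - P*)` is the Laplacian of
the network. The free field is a Gaussian with quadratic form `L`, so its partition function is
`(2π)^(|V|/2) (det L)^(-1/2)`. Finiteness of `Z` makes the trace series converge, hence `det L > 0`.
This also makes `1 - P*` invertible, so Green's function is finite. -/

noncomputable section

namespace NBLoop


/-! ### Determinants and traces through eigenvalues. -/

section Spectral

open Polynomial Matrix

variable {n K : Type*} [Fintype n] [DecidableEq n] [Field K] [IsAlgClosed K]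

theorem card_roots_charpoly (A : Matrix n n K) : A.charpoly.roots.card = Fintype.card n := by
  rw [← (IsAlgClosed.splits A.charpoly).natDegree_eq_card_roots, charpoly_natDegree_eq_dim]

theorem eval_charpoly_eq_prod_roots (A : Matrix n n K) (μ : K) :
    A.charpoly.eval μ = (A.charpoly.roots.map (μ - ·)).prod := by
  conv_lhs => rw [(IsAlgClosed.splits A.charpoly).eq_prod_roots, A.charpoly_monic.leadingCoeff]
  simp [eval_multiset_prod, Multiset.map_map]

/-- Both sides are multiplicative in `q`, and `q` splits. This leaves constants, where the number of
roots matters, and linear factors, where the determinant is a value of the characteristic polynomial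
up to sign. -/
theorem det_aeval_eq_prod_roots_charpoly (A : Matrix n n K) (q : K[X]) :
    (aeval A q).det = (A.charpoly.roots.map (q.eval ·)).prod := by
  have hq : Splits q := IsAlgClosed.splits q
  unfold Splits at hq
  induction hq using Submonoid.closure_induction with
  | mem p hp =>
    rcases hp with ⟨a, rfl⟩ | ⟨a, rfl⟩
    · simp [card_roots_charpoly, Matrix.algebraMap_eq_diagonal]
    · have h := eval_charpoly_eq_prod_roots A (-a)
      rw [eval_charpoly] at h
      have h1 : aeval A (X + C a) = -(scalar n (-a) - A) := by
        simp [Matrix.algebraMap_eq_diagonal]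
        ext i j; simp [Matrix.diagonal_apply]; split_ifs <;> simp
      have h2 : (A.charpoly.roots.map fun r => (X + C a).eval r) =
          (A.charpoly.roots.map (-a - ·)).map Neg.neg := by
        simp [Multiset.map_map, add_comm]
      rw [h1, det_neg, h, h2, Multiset.prod_map_neg]
      simp [card_roots_charpoly]
  | one => simp
  | mul p q _ _ hp hq => simp [hp, hq, Multiset.prod_map_mul]

theorem trace_pow_eq_sum_roots_charpoly (A : Matrix n n K) (k : ℕ) :
    (A ^ k).trace = (A.charpoly.roots.map (· ^ k)).sum := by
  have : (A ^ k).charpoly = ((A.charpoly.roots.map (· ^ k)).map (X - C ·)).prod := by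
    refine Polynomial.funext fun μ => ?_
    -- This polynomial turns the determinant into the characteristic polynomial of `A ^ k` at `μ`,
    -- so the eigenvalues of `A ^ k` are the `k`-th powers with multiplicity.
    have h := det_aeval_eq_prod_roots_charpoly A (C μ - X ^ k)
    rw [eval_charpoly, eval_multiset_prod]
    simpa [Multiset.map_map, Matrix.algebraMap_eq_diagonal, Function.comp_def, Pi.algebraMap_def] using h
  rw [trace_eq_sum_roots_charpoly, this, roots_multiset_prod_X_sub_C]

theorem det_one_sub_smul_eq_prod_roots_charpoly (A : Matrix n n K) (t : K) :
    (1 - t • A).det = (A.charpoly.roots.map (1 - t * ·)).prod := by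
  have h := det_aeval_eq_prod_roots_charpoly A (1 - C t * X)
  simpa [← Algebra.smul_def] using h

end Spectral

/-! ### The determinant as the exponential of a trace series. -/

section LogDet

open Matrix Filter Topology

variable {n : Type*} [Fintype n] [DecidableEq n]

/-- Each eigenvalue `r` contributes the Taylor series of `-log (1 - t r)`, and exponentiating
removes the choice of branch. The term `k = 0` vanishes since division by zero gives zero. -/
theorem exp_neg_tsum_trace_of_small (A : Matrix n n ℂ) {t : ℂ}
    (ht : ∀ r ∈ A.charpoly.roots, ‖t * r‖ < 1) :
    Complex.exp (-∑' k : ℕ, (A ^ k).trace / k * t ^ k) = (1 - t • A).det := by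
  have h (s : Multiset ℂ) (hs : ∀ r ∈ s, ‖t * r‖ < 1) :
      HasSum (fun k : ℕ => (s.map (· ^ k)).sum / k * t ^ k)
        (s.map fun r => -Complex.log (1 - t * r)).sum := by
    induction s using Multiset.induction with
    | empty => simp
    | cons a s ih =>
      simp only [Multiset.map_cons, Multiset.sum_cons]
      convert! (Complex.hasSum_taylorSeries_neg_log (hs a (by simp))).add
        (ih fun r hr => hs r (by simp [hr])) using 2
      ring
  simp only [trace_pow_eq_sum_roots_charpoly]
  rw [(h _ ht).tsum_eq, det_one_sub_smul_eq_prod_roots_charpoly]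
  rw [← Multiset.sum_map_neg', Multiset.map_map, Complex.exp_multiset_sum, Multiset.map_map]
  congr 1
  refine Multiset.map_congr rfl fun r hr => ?_
  simp only [Function.comp, neg_neg]
  refine Complex.exp_log fun h0 => ?_
  have := ht r hr
  rw [← sub_eq_zero.1 h0] at this
  simp at this

/-- If `∑ tr(Aᵏ)/k` converges absolutely, then `det (1 - A) = exp (-∑ tr(Aᵏ)/k)`. -/
theorem det_one_sub_eq_exp_neg_tsum_trace (A : Matrix n n ℂ)
    (hA : Summable fun k : ℕ => ‖(A ^ k).trace / k‖) :
    (1 - A).det = Complex.exp (-∑' k : ℕ, (A ^ k).trace / k) := by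
  -- Absolute convergence at `t = 1` dominates the series on the closed unit disc, so no bound on
  -- the spectral radius is needed. `F` agrees with the determinant near `0`, then on the open disc
  -- by the identity theorem, then at `t = 1` by continuity.
  set F : ℂ → ℂ := fun t => Complex.exp (-∑' k : ℕ, (A ^ k).trace / k * t ^ k) with hF
  have hbound : ∀ (k : ℕ) (t : ℂ), t ∈ Metric.closedBall (0 : ℂ) 1 →
      ‖(A ^ k).trace / k * t ^ k‖ ≤ ‖(A ^ k).trace / k‖ := by
    intro k t ht
    rw [norm_mul, norm_pow]
    refine mul_le_of_le_one_right (norm_nonneg _) (pow_le_one₀ (norm_nonneg _) ?_)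
    simpa using ht
  have hcont : ContinuousOn F (Metric.closedBall 0 1) :=
    Complex.continuous_exp.comp_continuousOn
      (continuousOn_tsum (fun k => by fun_prop) hA hbound).neg
  have hdiff : DifferentiableOn ℂ F (Metric.ball 0 1) :=
    (Complex.differentiableOn_tsum_of_summable_norm hA (fun k => by fun_prop)
      Metric.isOpen_ball fun k t ht => hbound k t (Metric.ball_subset_closedBall ht)).neg.cexp
  have hdetd : Differentiable ℂ fun t : ℂ => (1 - t • A).det := by
    simp only [det_apply', Matrix.sub_apply, Matrix.smul_apply, smul_eq_mul]
    fun_prop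
  have hball : Set.EqOn F (fun t => (1 - t • A).det) (Metric.ball 0 1) := by
    refine (hdiff.analyticOnNhd Metric.isOpen_ball).eqOn_of_preconnected_of_eventuallyEq
      (hdetd.differentiableOn.analyticOnNhd Metric.isOpen_ball)
      (convex_ball (0 : ℂ) 1).isPreconnected (z₀ := 0) (by simp) ?_
    have hev : ∀ᶠ t : ℂ in 𝓝 0, ∀ r ∈ A.charpoly.roots.toFinset, ‖t * r‖ < 1 := by
      rw [Finset.eventually_all]
      intro r _
      have : Tendsto (fun t : ℂ => ‖t * r‖) (𝓝 0) (𝓝 0) := by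
        have h : Continuous fun t : ℂ => ‖t * r‖ := by fun_prop
        simpa using h.tendsto 0
      exact this.eventually_lt_const one_pos
    filter_upwards [hev] with t ht
    exact exp_neg_tsum_trace_of_small A fun r hr => ht r (by simpa using hr)
  have hclosed : Set.EqOn F (fun t => (1 - t • A).det) (Metric.closedBall 0 1) := by
    refine hball.of_subset_closure hcont hdetd.continuous.continuousOn
      Metric.ball_subset_closedBall ?_
    rw [closure_ball _ one_ne_zero]
  have h1 := hclosed (x := 1) (by simp)
  simpa [hF] using h1.symm

theorem det_one_sub_eq_exp_neg_tsum_trace_real (A : Matrix n n ℝ)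
    (hA : Summable fun k : ℕ => ‖(A ^ k).trace / k‖) :
    (1 - A).det = Real.exp (-∑' k : ℕ, (A ^ k).trace / k) := by
  have htr : ∀ k : ℕ, ((A.map Complex.ofRealHom) ^ k).trace / k =
      (((A ^ k).trace / k : ℝ) : ℂ) := by
    intro k
    rw [← Matrix.map_pow]
    simp [Matrix.trace]
  have h := det_one_sub_eq_exp_neg_tsum_trace (A.map Complex.ofRealHom) (by
    simp only [htr, Complex.norm_real]; exact hA)
  simp only [htr] at h
  have hd : (1 - A.map Complex.ofRealHom).det = (((1 - A).det : ℝ) : ℂ) := by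
    have := Complex.ofRealHom.map_det (1 - A)
    rw [RingHom.mapMatrix_apply, Matrix.map_sub _ (map_sub _), Matrix.map_one _ (map_zero _) (map_one _)] at this
    exact this.symm
  rw [hd, ← Complex.ofReal_tsum] at h
  exact_mod_cast h

end LogDet


/-! ### The exponential formula for sums over multisets. -/

section ExpFormula

open Filter Topology NNReal
open scoped Nat

variable {ι : Type*} [DecidableEq ι]

/-- The Boltzmann weight `∏ᵢ aᵢ ^ mᵢ / mᵢ!` of a multiset with multiplicities `mᵢ`. -/
def multisetWeight (a : ι → ℝ≥0) (L : Multiset ι) : ℝ≥0 :=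
  ∏ i ∈ L.toFinset, a i ^ L.count i / (L.count i)!

/-- The number of orderings of `L` is the multinomial coefficient `(L.card)! / ∏ mᵢ!`. This matches
the Boltzmann weight with the terms of a multinomial expansion. -/
theorem countPerms_mul_prod (a : ι → ℝ≥0) (L : Multiset ι) :
    (L.countPerms : ℝ≥0) * (L.map a).prod = (L.card)! * multisetWeight a L := by
  have h := Nat.multinomial_spec L.toFinset (fun i => L.count i)
  rw [Multiset.toFinset_sum_count_eq] at h
  have h2 : L.countPerms = Nat.multinomial L.toFinset (fun i => L.count i) := by
    rw [Multiset.countPerms, Finsupp.multinomial_eq]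
    simp
    rfl
  have hne : ((∏ i ∈ L.toFinset, (L.count i)! : ℕ) : ℝ≥0) ≠ 0 := by
    exact_mod_cast (Finset.prod_pos fun i _ => Nat.factorial_pos _).ne'
  rw [h2, ← h, multisetWeight, Finset.prod_div_distrib, Finset.prod_multiset_map_count]
  push_cast at hne ⊢
  field_simp

theorem sum_sym_multisetWeight (a : ι → ℝ≥0) (s : Finset ι) (n : ℕ) :
    ∑ k ∈ s.sym n, multisetWeight a k = (∑ i ∈ s, a i) ^ n / n ! := by
  have hn : (n ! : ℝ≥0) ≠ 0 := by exact_mod_cast n.factorial_ne_zero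
  rw [Finset.sum_pow, eq_div_iff hn, Finset.sum_mul]
  refine Finset.sum_congr rfl fun k _ => ?_
  have := countPerms_mul_prod a (k : Multiset ι)
  rw [show (k : Multiset ι).card = n from k.2] at this
  rw [mul_comm]
  exact this.symm

theorem tsum_sym_multisetWeight (a : ι → ℝ≥0) (n : ℕ) :
    ∑' k : Sym ι n, (multisetWeight a k : ℝ≥0∞) = (∑' i, (a i : ℝ≥0∞)) ^ n / n ! := by
  have hn : (n ! : ℝ≥0) ≠ 0 := by exact_mod_cast n.factorial_ne_zero
  have hs : ∀ s : Finset ι, ∑ k ∈ s.sym n, (multisetWeight a k : ℝ≥0∞) =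
      (∑ i ∈ s, (a i : ℝ≥0∞)) ^ n / n ! := by
    intro s
    rw [← ENNReal.ofNNReal_finsetSum, sum_sym_multisetWeight, ENNReal.coe_div hn]
    push_cast
    rfl
  apply le_antisymm
  · refine ENNReal.summable.tsum_le_of_sum_le fun T => ?_
    -- Finitely many multisets use finitely many elements, so the finite multinomial theorem on `s`
    -- bounds their sum.
    let s : Finset ι := T.biUnion fun k => (k : Multiset ι).toFinset
    have hT : T ⊆ s.sym n := by
      intro k hk
      rw [Finset.mem_sym_iff]
      intro i hi
      exact Finset.mem_biUnion.2 ⟨k, hk, by simpa using hi⟩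
    calc _ ≤ ∑ k ∈ s.sym n, (multisetWeight a k : ℝ≥0∞) := Finset.sum_le_sum_of_subset hT
      _ ≤ _ := by
        rw [hs]
        gcongr
        exact ENNReal.sum_le_tsum s
  · have ht : Tendsto (fun s : Finset ι => (∑ i ∈ s, (a i : ℝ≥0∞)) ^ n / n !) atTop
        (𝓝 ((∑' i, (a i : ℝ≥0∞)) ^ n / n !)) :=
      ENNReal.Tendsto.div_const ((ENNReal.continuous_pow n).continuousAt.tendsto.comp
        ENNReal.summable.hasSum) (Or.inr (by exact_mod_cast n.factorial_ne_zero))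
    refine le_of_tendsto' ht fun s => ?_
    rw [← hs]
    exact ENNReal.sum_le_tsum _

theorem tsum_multisetWeight (a : ι → ℝ≥0) :
    ∑' L : Multiset ι, (multisetWeight a L : ℝ≥0∞) =
      ∑' n : ℕ, (∑' i, (a i : ℝ≥0∞)) ^ n / n ! := by
  rw [← (Equiv.sigmaFiberEquiv (Multiset.card (α := ι))).tsum_eq, ENNReal.tsum_sigma']
  exact tsum_congr fun n => tsum_sym_multisetWeight a n

/-- The multisets with one element already contribute the left side; finiteness of the partition
function thus passes to the total mass. -/
theorem tsum_le_tsum_multisetWeight (a : ι → ℝ≥0) :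
    ∑' i, (a i : ℝ≥0∞) ≤ ∑' L : Multiset ι, (multisetWeight a L : ℝ≥0∞) := by
  rw [tsum_multisetWeight]
  simpa using ENNReal.le_tsum (f := fun n : ℕ => (∑' i, (a i : ℝ≥0∞)) ^ n / n !) 1

theorem tsum_multisetWeight_eq_exp (a : ι → ℝ≥0) (ha : ∑' i, (a i : ℝ≥0∞) ≠ ⊤) :
    ∑' L : Multiset ι, (multisetWeight a L : ℝ≥0∞) =
      ENNReal.ofReal (Real.exp (∑' i, (a i : ℝ≥0∞)).toReal) := by
  rw [tsum_multisetWeight]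
  set S := ∑' i, (a i : ℝ≥0∞)
  have hS : HasSum (fun n : ℕ => S.toReal ^ n / n !) (Real.exp S.toReal) := by
    rw [Real.exp_eq_exp_ℝ]
    exact NormedSpace.expSeries_div_hasSum_exp S.toReal
  rw [← hS.tsum_eq, ENNReal.ofReal_tsum_of_nonneg (fun n => by positivity) hS.summable]
  refine tsum_congr fun n => ?_
  rw [ENNReal.ofReal_div_of_pos (by positivity), ENNReal.ofReal_pow ENNReal.toReal_nonneg,
    ENNReal.ofReal_toReal ha, ENNReal.ofReal_natCast]

end ExpFormula


variable {V : Type*} {G : SimpleGraph V}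

/-! ### Counting the rooted representatives of a loop. -/

namespace RootedLoop

theorem shift_len (ω : RootedLoop G) : ω.shift ω.len = ω := by
  ext1
  · rfl
  · funext i; exact ω.periodic i

/-- The shifts that fix a rooted loop. -/
def periods (ω : RootedLoop G) : AddSubgroup ℤ where
  carrier := {k | ω.shift k = ω}
  zero_mem' := ω.shift_zero
  add_mem' {a b} ha hb := by
    simp only [Set.mem_ofPred_eq] at *
    rw [← shift_shift, hb, ha]
  neg_mem' {a} ha := by
    simp only [Set.mem_ofPred_eq] at *
    conv_lhs => rw [← ha, shift_shift, neg_add_cancel, shift_zero]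

/-- The shifts fixing `ω` form a subgroup of `ℤ`, hence a cyclic one, and it is nonzero because it
contains the length. -/
theorem exists_period (ω : RootedLoop G) :
    ∃ p : ℕ, 0 < p ∧ ∀ k : ℤ, ω.shift k = ω ↔ (p : ℤ) ∣ k := by
  obtain ⟨a, ha⟩ := Int.subgroup_cyclic ω.periods
  have h : ∀ k : ℤ, ω.shift k = ω ↔ (a.natAbs : ℤ) ∣ k := by
    intro k
    rw [Int.natAbs_dvd, ← Int.mem_zmultiples_iff, AddSubgroup.zmultiples_eq_closure, ← ha]
    rfl
  refine ⟨a.natAbs, Nat.pos_of_ne_zero fun h0 => ?_, h⟩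
  have := (h ω.len).1 ω.shift_len
  rw [h0] at this
  have hl := ω.len_pos
  simp at this
  omega

/-- Cutting `ω` to length `p` shows that `len / p` copies are possible. More are not, since the
length of any repeated block is itself a period and so a multiple of `p`. -/
theorem multiplicity_mul_period (ω : RootedLoop G) {p : ℕ} (hp : 0 < p)
    (h : ∀ k : ℤ, ω.shift k = ω ↔ (p : ℤ) ∣ k) : ω.multiplicity * p = ω.len := by
  have hdvd : p ∣ ω.len := by exact_mod_cast (h ω.len).1 ω.shift_len
  obtain ⟨m, hm⟩ := hdvd
  have hlen := ω.len_pos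
  have hm0 : 0 < m := Nat.pos_of_ne_zero fun h0 => by simp [h0] at hm; omega
  have hg : IsGreatest {m | ∃ (ω' : RootedLoop G) (hm : 0 < m), ω = ω'.repeated m hm} m := by
    constructor
    · refine ⟨⟨p, hp, ω.dart, fun i => ?_, ω.step⟩, hm0, ?_⟩
      · exact congrFun (congrArg RootedLoop.dart ((h p).2 dvd_rfl)) i
      · ext1
        · simp [repeated, hm, mul_comm]
        · rfl
    · rintro l ⟨ω', hl, he⟩
      have h1 : ω.len = l * ω'.len := congrArg RootedLoop.len he
      have h2 : ω.dart = ω'.dart := congrArg (fun ω => ω.dart) he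
      have h3 : p ∣ ω'.len := by
        have : ω.shift ω'.len = ω := by
          ext1
          · rfl
          · funext i
            simp only [shift, h2, ω'.periodic]
        exact_mod_cast (h _).1 this
      have h4 := Nat.le_of_dvd ω'.len_pos h3
      rw [hm] at h1
      by_contra! hlt
      have : p * m < l * ω'.len := by nlinarith
      omega
  unfold multiplicity
  rw [hg.csSup_eq, hm, mul_comm]

/-- A reflection of the index line fixes an integer or swaps two neighbours, according to the parity
of `k - j`. In the first case a directed edge would equal its reversal; in the second the walk would
backtrack. -/
theorem shift_ne_reverse_shift (ω : RootedLoop G) (j k : ℤ) :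
    ω.shift j ≠ (ω.shift k).reverse := by
  intro h
  have hd : ∀ i, ω.dart (i + j) = (ω.dart (-i + k)).symm :=
    fun i => congrFun (congrArg RootedLoop.dart h) i
  rcases Int.even_or_odd' (k - j) with ⟨c, hc | hc⟩
  · have := hd c
    rw [show -c + k = c + j by omega] at this
    exact (ω.dart (c + j)).symm_ne this.symm
  · have := hd (c + 1)
    rw [show -(c + 1) + k = c + j by omega, show c + 1 + j = c + j + 1 by ring] at this
    exact (ω.step (c + j)).2 this

theorem shift_eq_shift_iff (ω : RootedLoop G) (j k : ℤ) :
    ω.shift j = ω.shift k ↔ ω.shift (j - k) = ω := by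
  constructor
  · intro h
    have := congrArg (fun ω' => RootedLoop.shift ω' (-k)) h
    simp only [shift_shift, neg_add_cancel, shift_zero] at this
    rwa [show j - k = -k + j by ring]
  · intro h
    have := congrArg (fun ω' => RootedLoop.shift ω' k) h
    simpa only [shift_shift, add_sub_cancel] using this

/-- A class consists of `p` shifts and `p` reversed shifts, for `p` the minimal period, and the two
families are disjoint. -/
theorem card_class_mul_multiplicity (ω : RootedLoop G) :
    (Nat.card {ω' // ω.Equivalent ω'}) * ω.multiplicity = 2 * ω.len ∧
      Finite {ω' // ω.Equivalent ω'} := by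
  obtain ⟨p, hp, h⟩ := ω.exists_period
  let f : Fin p ⊕ Fin p → {ω' // ω.Equivalent ω'} := Sum.elim
    (fun k => ⟨ω.shift (k : ℕ), (k : ℕ), Or.inl rfl⟩)
    (fun k => ⟨(ω.shift (k : ℕ)).reverse, (k : ℕ), Or.inr rfl⟩)
  have hinj0 : ∀ a b : Fin p, ω.shift (a : ℕ) = ω.shift (b : ℕ) → a = b := by
    intro a b hab
    rw [shift_eq_shift_iff, h] at hab
    have ha := a.2
    have hb := b.2
    have := Int.eq_zero_of_abs_lt_dvd hab (by rw [abs_lt]; constructor <;> omega)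
    ext; omega
  have hsurj0 : ∀ k : ℤ, ∃ a : Fin p, ω.shift k = ω.shift (a : ℕ) := by
    intro k
    have hk0 := Int.emod_nonneg k (b := p) (by omega)
    have hk1 := Int.emod_lt_of_pos k (b := p) (by omega)
    refine ⟨⟨(k % p).toNat, by omega⟩, ?_⟩
    rw [shift_eq_shift_iff, h]
    simp only [Int.toNat_of_nonneg hk0]
    exact Int.dvd_self_sub_emod
  have hf : Function.Bijective f := by
    constructor
    · rintro (a | a) (b | b) hab
      · replace hab := congrArg Subtype.val hab
        rw [hinj0 a b hab]
      · replace hab := congrArg Subtype.val hab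
        exact (ω.shift_ne_reverse_shift _ _ hab).elim
      · replace hab := congrArg Subtype.val hab
        exact (ω.shift_ne_reverse_shift _ _ hab.symm).elim
      · replace hab := congrArg Subtype.val hab
        have : (ω.shift (a : ℕ)).reverse.reverse = (ω.shift (b : ℕ)).reverse.reverse :=
          congrArg RootedLoop.reverse hab
        rw [reverse_reverse, reverse_reverse] at this
        rw [hinj0 a b this]
    · rintro ⟨ω', k, rfl | rfl⟩
      · obtain ⟨a, ha⟩ := hsurj0 k
        exact ⟨Sum.inl a, Subtype.ext ha.symm⟩
      · obtain ⟨a, ha⟩ := hsurj0 k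
        exact ⟨Sum.inr a, Subtype.ext (congrArg RootedLoop.reverse ha.symm)⟩
  refine ⟨?_, Finite.of_surjective f hf.2⟩
  rw [← Nat.card_congr (Equiv.ofBijective f hf), ← ω.multiplicity_mul_period hp h]
  simp
  ring

theorem Equivalent.len_eq {ω ω' : RootedLoop G} (h : ω.Equivalent ω') : ω.len = ω'.len := by
  obtain ⟨k, rfl | rfl⟩ := h <;> rfl

theorem weight_nonneg (x : G.edgeSet → ℝ) (ω : RootedLoop G) : 0 ≤ ω.weight x :=
  Finset.prod_nonneg fun _ _ => Real.sqrt_nonneg _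

end RootedLoop

theorem loopMeasure_nonneg (x : G.edgeSet → ℝ) (ℓ : Loop G) : 0 ≤ loopMeasure x ℓ := by
  induction ℓ using Quotient.inductionOn with
  | h ω => exact div_nonneg (ω.weight_nonneg x) (Nat.cast_nonneg _)

/-- The total loop measure as a sum over rooted loops. -/
theorem tsum_loopMeasure (x : G.edgeSet → ℝ) :
    ∑' ℓ : Loop G, ENNReal.ofReal (loopMeasure x ℓ) =
      ∑' ω : RootedLoop G, ENNReal.ofReal (ω.weight x / (2 * ω.len)) := by
  rw [← (Equiv.sigmaFiberEquiv (Quotient.mk (RootedLoop.setoid G))).tsum_eq, ENNReal.tsum_sigma']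
  refine tsum_congr fun ℓ => ?_
  induction ℓ using Quotient.inductionOn with
  | h ω =>
    have hfib : ∀ ω' : {ω' // Quotient.mk (RootedLoop.setoid G) ω' = ⟦ω⟧},
        ω.Equivalent ω'.1 := fun ω' => Setoid.symm (Quotient.exact ω'.2)
    let e : {ω' // Quotient.mk (RootedLoop.setoid G) ω' = ⟦ω⟧} ≃ {ω' // ω.Equivalent ω'} :=
      Equiv.subtypeEquivRight fun ω' =>
        ⟨fun h => Setoid.symm (Quotient.exact h), fun h => Quotient.sound (Setoid.symm h)⟩
    obtain ⟨hc, hfin⟩ := ω.card_class_mul_multiplicity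
    have hconst : ∀ ω' : {ω' // Quotient.mk (RootedLoop.setoid G) ω' = ⟦ω⟧},
        ENNReal.ofReal ((Equiv.sigmaFiberEquiv (Quotient.mk (RootedLoop.setoid G))
          ⟨_, ω'⟩).weight x / (2 * (Equiv.sigmaFiberEquiv (Quotient.mk (RootedLoop.setoid G))
          ⟨_, ω'⟩).len)) = ENNReal.ofReal (ω.weight x / (2 * ω.len)) := by
      intro ω'
      change ENNReal.ofReal (ω'.1.weight x / (2 * ω'.1.len)) = _
      rw [← (hfib ω').weight_eq, ← (hfib ω').len_eq]
    rw [tsum_congr hconst, ENNReal.tsum_const, ENat.card_congr e]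
    rw [ENat.card_eq_coe_natCard]
    have hlen := ω.len_pos
    have hm : ω.multiplicity ≠ 0 := by
      intro h0
      rw [h0] at hc
      omega
    have hc' : (Nat.card {ω' // ω.Equivalent ω'} : ℝ) * ω.multiplicity = 2 * ω.len := by
      exact_mod_cast hc
    have hm' : (ω.multiplicity : ℝ) ≠ 0 := by exact_mod_cast hm
    have hl' : (ω.len : ℝ) ≠ 0 := by exact_mod_cast hlen.ne'
    rw [ENat.toENNReal_coe, ← ENNReal.ofReal_natCast, ← ENNReal.ofReal_mul (Nat.cast_nonneg _)]
    congr 1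
    change ω.weight x / ω.multiplicity = _
    rw [← hc']
    have : (Nat.card {ω' // ω.Equivalent ω'} : ℝ) ≠ 0 := by
      intro h0
      rw [h0] at hc'
      simp at hc'
      exact hlen.ne' hc'
    field_simp


/-! ### Rooted loops and traces of matrix powers. -/

section ClosedWalks

open Matrix

variable {D : Type*} [Fintype D] [DecidableEq D]

/-- The arbitrary weight `g` on the end points lets the induction absorb the first step; the choice
`g a b = A b a` later closes the walk. -/
theorem sum_walks_eq_sum_pow (A : Matrix D D ℝ) (n : ℕ) (g : D → D → ℝ) :
    ∑ f : Fin (n + 1) → D, g (f 0) (f (Fin.last n)) * ∏ i : Fin n, A (f i.castSucc) (f i.succ) =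
      ∑ a, ∑ b, g a b * (A ^ n) a b := by
  induction n generalizing g with
  | zero =>
    rw [← (Equiv.funUnique (Fin 1) D).symm.sum_comp]
    refine Finset.sum_congr rfl fun a _ => ?_
    simp [Matrix.one_apply]
  | succ n ih =>
    rw [← (Fin.consEquiv fun _ : Fin (n + 2) => D).sum_comp, Fintype.sum_prod_type]
    have h : ∀ a : D, ∀ f : Fin (n + 1) → D,
        g ((Fin.consEquiv fun _ : Fin (n + 2) => D) (a, f) 0)
          ((Fin.consEquiv fun _ : Fin (n + 2) => D) (a, f) (Fin.last (n + 1))) *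
          ∏ i : Fin (n + 1), A ((Fin.consEquiv fun _ : Fin (n + 2) => D) (a, f) i.castSucc)
            ((Fin.consEquiv fun _ : Fin (n + 2) => D) (a, f) i.succ) =
        (fun c b => g a b * A a c) (f 0) (f (Fin.last n)) *
          ∏ i : Fin n, A (f i.castSucc) (f i.succ) := by
      intro a f
      rw [Fin.prod_univ_succ]
      simp only [Fin.consEquiv_apply, Fin.cons_zero, Fin.castSucc_zero, Fin.cons_succ,
        ← Fin.succ_last, ← Fin.succ_castSucc]
      ring
    refine Finset.sum_congr rfl fun a _ => ?_
    rw [Finset.sum_congr rfl fun f _ => h a f, ih fun c b => g a b * A a c, Finset.sum_comm]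
    refine Finset.sum_congr rfl fun b _ => ?_
    rw [pow_succ', Matrix.mul_apply, Finset.mul_sum]
    exact Finset.sum_congr rfl fun c _ => by ring

theorem trace_pow_succ_eq_sum_closed_walks (A : Matrix D D ℝ) (n : ℕ) :
    (A ^ (n + 1)).trace = ∑ f : Fin (n + 1) → D, ∏ i, A (f i) (f (i + 1)) := by
  have h := sum_walks_eq_sum_pow A n fun a b => A b a
  have h2 : ∀ f : Fin (n + 1) → D, ∏ i, A (f i) (f (i + 1)) =
      A (f (Fin.last n)) (f 0) * ∏ i : Fin n, A (f i.castSucc) (f i.succ) := by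
    intro f
    rw [Fin.prod_univ_castSucc, Fin.last_add_one, mul_comm]
    simp only [Fin.coeSucc_eq_succ]
  simp only [h2, h, Matrix.trace, Matrix.diag, pow_succ, Matrix.mul_apply]
  exact Finset.sum_congr rfl fun a _ => Finset.sum_congr rfl fun b _ => mul_comm _ _

/-- `ZMod (n + 1)` is `Fin (n + 1)` by definition, and indices wrap around in both. -/
theorem trace_pow_succ_eq_sum_zmod (A : Matrix D D ℝ) (n : ℕ) :
    (A ^ (n + 1)).trace = ∑ f : ZMod (n + 1) → D, ∏ i, A (f i) (f (i + 1)) :=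
  trace_pow_succ_eq_sum_closed_walks A n

end ClosedWalks

namespace RootedLoop

theorem dart_eq_of_cast_eq (ω : RootedLoop G) {j k : ℤ}
    (h : (j : ZMod ω.len) = (k : ZMod ω.len)) : ω.dart j = ω.dart k := by
  obtain ⟨c, hc⟩ := (ZMod.intCast_eq_intCast_iff_dvd_sub _ _ _).1 h
  have hp : Function.Periodic ω.dart (ω.len : ℤ) := ω.periodic
  have := hp.int_mul c j
  rw [← this]
  congr 1
  push_cast
  linarith

/-- Rooted loops of length `n + 1` as functions on the cyclic group of order `n + 1`. -/
def equivCyclic (G : SimpleGraph V) (n : ℕ) :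
    {ω : RootedLoop G // ω.len = n + 1} ≃
      {f : ZMod (n + 1) → G.Dart // ∀ i, Step (f i) (f (i + 1))} where
  toFun ω := ⟨fun i => ω.1.dart ((i.val : ℕ) : ℤ), fun i => by
    obtain ⟨ω, h⟩ := ω
    have := ω.step ((i.val : ℕ) : ℤ)
    convert this using 1
    apply ω.dart_eq_of_cast_eq
    rw [h]
    push_cast
    rw [ZMod.natCast_zmod_val, ZMod.natCast_zmod_val]⟩
  invFun f := ⟨⟨n + 1, n.succ_pos, fun i => f.1 (i : ZMod (n + 1)), fun i => by
      have : ((n : ZMod (n + 1)) + 1) = 0 := by exact_mod_cast ZMod.natCast_self (n + 1)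
      push_cast
      rw [this, add_zero], fun i => by
      have := f.2 (i : ZMod (n + 1))
      rwa [Int.cast_add, Int.cast_one]⟩, rfl⟩
  left_inv := by
    rintro ⟨ω, h⟩
    apply Subtype.ext
    ext1
    · exact h.symm
    · funext i
      apply ω.dart_eq_of_cast_eq
      rw [h]
      push_cast
      rw [ZMod.natCast_zmod_val]
  right_inv := by
    rintro ⟨f, hf⟩
    apply Subtype.ext
    funext i
    change f (((i.val : ℕ) : ℤ) : ZMod (n + 1)) = f i
    congr 1
    push_cast
    rw [ZMod.natCast_zmod_val]

end RootedLoop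

open Classical in
/-- The transition matrix of the non-backtracking walk on directed edges. -/
def stepMatrix (x : G.edgeSet → ℝ) : Matrix G.Dart G.Dart ℝ := fun d d' =>
  if Step d d' then Real.sqrt (x ⟨d.edge, d.edge_mem⟩ * x ⟨d'.edge, d'.edge_mem⟩) else 0

theorem stepMatrix_nonneg (x : G.edgeSet → ℝ) (d d' : G.Dart) : 0 ≤ stepMatrix x d d' := by
  unfold stepMatrix
  split_ifs
  · exact Real.sqrt_nonneg _
  · exact le_rfl

theorem weight_eq_prod_equivCyclic (x : G.edgeSet → ℝ) (n : ℕ)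
    (ω : {ω : RootedLoop G // ω.len = n + 1}) :
    ω.1.weight x = ∏ i, stepMatrix x ((RootedLoop.equivCyclic G n ω).1 i)
      ((RootedLoop.equivCyclic G n ω).1 (i + 1)) := by
  have h : ∀ i, stepMatrix x ((RootedLoop.equivCyclic G n ω).1 i)
      ((RootedLoop.equivCyclic G n ω).1 (i + 1)) =
      Real.sqrt (x ⟨(ω.1.dart (i.val : ℕ)).edge, (ω.1.dart (i.val : ℕ)).edge_mem⟩ *
      x ⟨(ω.1.dart ((i.val : ℕ) + 1)).edge, (ω.1.dart ((i.val : ℕ) + 1)).edge_mem⟩) := by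
    intro i
    unfold stepMatrix
    rw [if_pos ((RootedLoop.equivCyclic G n ω).2 i)]
    have h1 : (RootedLoop.equivCyclic G n ω).1 i = ω.1.dart (i.val : ℕ) := rfl
    have h2 : (RootedLoop.equivCyclic G n ω).1 (i + 1) = ω.1.dart ((i.val : ℕ) + 1) := by
      apply ω.1.dart_eq_of_cast_eq
      rw [ω.2]
      push_cast
      rw [ZMod.natCast_zmod_val, ZMod.natCast_zmod_val]
    simp only [h1, h2]
  simp only [h, RootedLoop.weight, ω.2, Finset.prod_range]
  rfl

/-- The trace sums over all cyclic sequences of directed edges, but a sequence with an inadmissible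
step has a zero factor, so only rooted loops remain. -/
theorem tsum_weight_of_len [Fintype G.Dart] [DecidableEq G.Dart] (x : G.edgeSet → ℝ) (n : ℕ) :
    ∑' ω : {ω : RootedLoop G // ω.len = n + 1}, ENNReal.ofReal (ω.1.weight x) =
      ENNReal.ofReal (stepMatrix x ^ (n + 1)).trace := by
  classical
  rw [trace_pow_succ_eq_sum_zmod]
  let F : (ZMod (n + 1) → G.Dart) → ℝ := fun f => ∏ i, stepMatrix x (f i) (f (i + 1))
  have hF : ∀ f, 0 ≤ F f := fun f => Finset.prod_nonneg fun i _ => stepMatrix_nonneg x _ _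
  have h1 : ∀ ω : {ω : RootedLoop G // ω.len = n + 1}, ENNReal.ofReal (ω.1.weight x) =
      ENNReal.ofReal (F (RootedLoop.equivCyclic G n ω).1) :=
    fun ω => by rw [weight_eq_prod_equivCyclic]
  rw [tsum_congr h1, (RootedLoop.equivCyclic G n).tsum_eq fun f => ENNReal.ofReal (F f.1),
    tsum_fintype, ENNReal.ofReal_sum_of_nonneg fun f _ => hF f]
  let p : (ZMod (n + 1) → G.Dart) → Prop := fun f => ∀ i, Step (f i) (f (i + 1))
  rw [← Finset.sum_filter_of_ne (p := p), Finset.sum_subtype _ (p := p) (by simp)]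
  intro f _ hf i
  by_contra hi
  refine hf ?_
  have h0 : F f = 0 := Finset.prod_eq_zero (Finset.mem_univ i) (if_neg hi)
  rw [h0, ENNReal.ofReal_zero]

/-- The total mass of the loop measure in terms of traces of powers of the transition matrix. -/
theorem tsum_loopMeasure_eq_tsum_trace [Fintype G.Dart] [DecidableEq G.Dart]
    (x : G.edgeSet → ℝ) :
    ∑' ℓ : Loop G, ENNReal.ofReal (loopMeasure x ℓ) =
      ∑' n : ℕ, ENNReal.ofReal (2⁻¹ * ((stepMatrix x ^ n).trace / n)) := by
  rw [tsum_loopMeasure, ← (Equiv.sigmaFiberEquiv (RootedLoop.len (G := G))).tsum_eq,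
    ENNReal.tsum_sigma']
  refine tsum_congr fun n => ?_
  rcases n with _ | n
  -- No loop has length `0`, and the term on the right is a division by zero, hence zero.
  · have : IsEmpty {ω : RootedLoop G // ω.len = 0} := ⟨fun ω => ω.1.len_pos.ne' ω.2⟩
    simp
  · have h : ∀ ω : {ω : RootedLoop G // ω.len = n + 1},
        ENNReal.ofReal ((Equiv.sigmaFiberEquiv (RootedLoop.len (G := G)) ⟨n + 1, ω⟩).weight x /
          (2 * (Equiv.sigmaFiberEquiv (RootedLoop.len (G := G)) ⟨n + 1, ω⟩).len)) =
        ENNReal.ofReal (ω.1.weight x) * ENNReal.ofReal (2 * (n + 1 : ℕ))⁻¹ := by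
      intro ω
      change ENNReal.ofReal (ω.1.weight x / (2 * ω.1.len)) = _
      rw [ω.2, ← ENNReal.ofReal_mul (ω.1.weight_nonneg x), div_eq_mul_inv]
    have htr : 0 ≤ (stepMatrix x ^ (n + 1)).trace := by
      rw [trace_pow_succ_eq_sum_zmod]
      exact Finset.sum_nonneg fun f _ => Finset.prod_nonneg fun i _ => stepMatrix_nonneg x _ _
    rw [tsum_congr h, ENNReal.tsum_mul_right, tsum_weight_of_len, ← ENNReal.ofReal_mul htr]
    congr 1
    rw [mul_inv]
    ring


/-! ### The Ihara–Bass reduction from directed edges to vertices. -/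

section IharaBass

open Matrix SimpleGraph

variable {V : Type*} {G : SimpleGraph V}

/-- The undirected edge underlying a directed edge. -/
def dartEdge (d : G.Dart) : G.edgeSet := ⟨d.edge, d.edge_mem⟩

theorem dartEdge_symm (d : G.Dart) : dartEdge d.symm = dartEdge d :=
  Subtype.ext d.edge_symm

theorem dartEdge_eq_iff (d d' : G.Dart) : dartEdge d = dartEdge d' ↔ d = d' ∨ d = d'.symm := by
  rw [← dart_edge_eq_iff, dartEdge, dartEdge, Subtype.mk.injEq]

theorem exists_dartEdge_eq (e : G.edgeSet) : ∃ d : G.Dart, dartEdge d = e := by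
  obtain ⟨e, he⟩ := e
  induction e using Sym2.inductionOn with
  | hf v u => exact ⟨⟨(v, u), he⟩, rfl⟩

/-- Choosing an orientation of each edge splits the directed edges in two copies of the edges. -/
def edgeSumEquivDart (G : SimpleGraph V) : G.edgeSet ⊕ G.edgeSet ≃ G.Dart :=
  Equiv.ofBijective (Sum.elim (fun e => (exists_dartEdge_eq e).choose)
    fun e => (exists_dartEdge_eq e).choose.symm) <| by
    have ho : ∀ e : G.edgeSet, dartEdge (exists_dartEdge_eq e).choose = e :=
      fun e => (exists_dartEdge_eq e).choose_spec
    have hs : ∀ e : G.edgeSet, dartEdge (exists_dartEdge_eq e).choose.symm = e :=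
      fun e => by rw [dartEdge_symm, ho]
    constructor
    · rintro (e | e) (e' | e') h
      · have := congrArg dartEdge h
        simp only [Sum.elim_inl, ho] at this
        rw [this]
      · have := congrArg dartEdge h
        simp only [Sum.elim_inl, Sum.elim_inr, ho, hs] at this
        subst this
        exact (Dart.symm_ne _ h.symm).elim
      · have := congrArg dartEdge h
        simp only [Sum.elim_inl, Sum.elim_inr, ho, hs] at this
        subst this
        exact (Dart.symm_ne _ h).elim
      · have := congrArg dartEdge h
        simp only [Sum.elim_inr, hs] at this
        rw [this]
    · intro d
      rcases (dartEdge_eq_iff _ _).1 (ho (dartEdge d)) with h | h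
      · exact ⟨Sum.inl (dartEdge d), h⟩
      · exact ⟨Sum.inr (dartEdge d), by simp only [Sum.elim_inr, h, Dart.symm_symm]⟩

theorem dartEdge_edgeSumEquivDart_inl (e : G.edgeSet) :
    dartEdge (edgeSumEquivDart G (Sum.inl e)) = e := (exists_dartEdge_eq e).choose_spec

theorem edgeSumEquivDart_inr (e : G.edgeSet) :
    edgeSumEquivDart G (Sum.inr e) = (edgeSumEquivDart G (Sum.inl e)).symm := rfl

theorem dartEdge_edgeSumEquivDart_inr (e : G.edgeSet) :
    dartEdge (edgeSumEquivDart G (Sum.inr e)) = e := by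
  rw [edgeSumEquivDart_inr, dartEdge_symm, dartEdge_edgeSumEquivDart_inl]

variable [Fintype V] [DecidableEq V] [DecidableRel G.Adj]

/-- A sum over edges at a vertex as a sum over the directed edges that start there. -/
theorem sum_dart_fst (g : G.edgeSet → ℝ) (v : V) :
    ∑ d : G.Dart with d.fst = v, g (dartEdge d) = ∑ e : G.edgeSet with v ∈ e.1, g e := by
  refine Finset.sum_bij (fun d _ => dartEdge d) ?_ ?_ ?_ fun _ _ => rfl
  · intro d hd
    simp only [Finset.mem_filter_univ] at hd ⊢
    rw [← hd]
    exact Sym2.mem_mk_left _ _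
  · intro d hd d' hd' h
    simp only [Finset.mem_filter_univ] at hd hd'
    rcases (dartEdge_eq_iff _ _).1 h with h | h
    · exact h
    · have h1 : d.fst = d'.snd := by rw [h]; rfl
      exact (d'.adj.ne (by rw [← h1, hd, hd'])).elim
  · intro e he
    simp only [Finset.mem_filter_univ] at he
    obtain ⟨d, rfl⟩ := exists_dartEdge_eq e
    rcases Sym2.mem_iff.1 (show v ∈ s(d.fst, d.snd) from he) with h | h
    · exact ⟨d, by simpa using h.symm, rfl⟩
    · exact ⟨d.symm, by simpa using h.symm, dartEdge_symm d⟩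

/-- A sum over directed edges as a sum over pairs of adjacent vertices. -/
theorem sum_dart_eq_sum_sum (g : G.edgeSet → ℝ) (h : V → V → ℝ) :
    ∑ d : G.Dart, g (dartEdge d) * h d.fst d.snd =
      ∑ v, ∑ u, (if hvu : G.Adj v u then g ⟨s(v, u), hvu⟩ else 0) * h v u := by
  rw [← Fintype.sum_prod_type' (f := fun v u =>
    (if hvu : G.Adj v u then g ⟨s(v, u), hvu⟩ else 0) * h v u)]
  refine Finset.sum_of_injOn (fun d => d.toProd) ?_ ?_ ?_ ?_
  · intro d _ d' _ hd
    exact Dart.ext _ _ hd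
  · simp
  · rintro ⟨v, u⟩ _ hvu
    have : ¬ G.Adj v u := fun hadj => hvu ⟨⟨(v, u), hadj⟩, by simp, rfl⟩
    simp [this]
  · intro d _
    rw [dif_pos d.adj]
    rfl

/-- The generalized Laplacian with conductances `c` and diagonal `r`. -/
def laplacian (c : G.edgeSet → ℝ) (r : V → ℝ) : Matrix V V ℝ :=
  Matrix.diagonal r - Matrix.of fun v u => if h : G.Adj v u then c ⟨s(v, u), h⟩ else 0

/-- The reversal of directed edges, weighted by `x`. -/
def reversalMatrix (x : G.edgeSet → ℝ) : Matrix G.Dart G.Dart ℝ := fun d d' =>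
  if d' = d.symm then x (dartEdge d') else 0

theorem reversalMatrix_mul_self (x : G.edgeSet → ℝ) :
    reversalMatrix x * reversalMatrix x = Matrix.diagonal fun d => x (dartEdge d) ^ 2 := by
  ext d d'
  simp only [reversalMatrix, Matrix.mul_apply, ite_mul, zero_mul, Finset.sum_ite_eq',
    Finset.mem_univ, if_true, Dart.symm_symm, dartEdge_symm, Matrix.diagonal_apply]
  by_cases h : d = d'
  · subst h; simp [sq]
  · rw [if_neg h, if_neg (fun h' => h h'.symm), mul_zero]

/-- After an orientation is chosen, the matrix pairs each edge with its reversal, giving a block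
`[[1, x_e], [x_e, 1]]` per edge. -/
theorem det_one_add_reversalMatrix (x : G.edgeSet → ℝ) :
    (1 + reversalMatrix x).det = ∏ e : G.edgeSet, (1 - x e ^ 2) := by
  rw [← Matrix.det_submatrix_equiv_self (edgeSumEquivDart G)]
  have h : (1 + reversalMatrix x).submatrix (edgeSumEquivDart G) (edgeSumEquivDart G) =
      Matrix.fromBlocks 1 (Matrix.diagonal x) (Matrix.diagonal x) 1 := by
    ext (e | e) (e' | e')
    · simp only [submatrix_apply, Matrix.add_apply, one_apply, reversalMatrix, fromBlocks_apply₁₁,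
        ← edgeSumEquivDart_inr, (edgeSumEquivDart G).injective.eq_iff, Sum.inl.injEq]
      simp
    · simp only [submatrix_apply, Matrix.add_apply, one_apply, reversalMatrix, fromBlocks_apply₁₂,
        ← edgeSumEquivDart_inr, (edgeSumEquivDart G).injective.eq_iff, Sum.inr.injEq,
        dartEdge_edgeSumEquivDart_inr, diagonal_apply]
      by_cases hh : e = e'
      · subst hh; simp
      · simp [hh, Ne.symm hh]
    · simp only [submatrix_apply, Matrix.add_apply, one_apply, reversalMatrix, fromBlocks_apply₂₁,
        edgeSumEquivDart_inr e, Dart.symm_symm]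
      simp only [← edgeSumEquivDart_inr, (edgeSumEquivDart G).injective.eq_iff, Sum.inl.injEq,
        dartEdge_edgeSumEquivDart_inl, diagonal_apply]
      by_cases hh : e = e'
      · subst hh; simp
      · simp [hh, Ne.symm hh]
    · simp only [submatrix_apply, Matrix.add_apply, one_apply, reversalMatrix, fromBlocks_apply₂₂,
        edgeSumEquivDart_inr e, Dart.symm_symm]
      simp only [← edgeSumEquivDart_inr, (edgeSumEquivDart G).injective.eq_iff, Sum.inr.injEq]
      simp
  rw [h, Matrix.det_fromBlocks_one₁₁, Matrix.diagonal_mul_diagonal, ← Matrix.diagonal_one,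
    Matrix.diagonal_sub, Matrix.det_diagonal]
  simp [sq]

/-- The incidence of directed edges with their end points. -/
def headMatrix (G : SimpleGraph V) : Matrix G.Dart V ℝ := fun d v => if d.snd = v then 1 else 0

/-- The incidence of directed edges with their starting points, weighted by `x`. -/
def tailMatrix (x : G.edgeSet → ℝ) : Matrix V G.Dart ℝ := fun v d =>
  if d.fst = v then x (dartEdge d) else 0

open Classical in
-- The product allows every continuation at the common vertex, and the reversal term removes the
-- backtracking one. The product factors through functions on `V`, which is what makes the reduction
-- to vertices possible.
theorem headMatrix_mul_tailMatrix_sub_reversalMatrix (x : G.edgeSet → ℝ) :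
    headMatrix G * tailMatrix x - reversalMatrix x =
      Matrix.of fun d d' => if Step d d' then x (dartEdge d') else 0 := by
  ext d d'
  simp only [Matrix.sub_apply, Matrix.mul_apply, headMatrix, tailMatrix, reversalMatrix, ite_mul,
    one_mul, zero_mul, Finset.sum_ite_eq, Finset.mem_univ, if_true, Matrix.of_apply, Step]
  by_cases h1 : d' = d.symm
  · subst h1; simp
  · simp [h1, eq_comm]

/-- Moving one factor `√x` cyclically, by `det (1 - MN) = det (1 - NM)`, replaces the symmetric
weight `√(x x')` by the weight `x'` of the edge entered. -/
theorem det_one_sub_stepMatrix (x : G.edgeSet → ℝ) (hx : ∀ e, 0 ≤ x e) :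
    (1 - stepMatrix x).det =
      (1 - (headMatrix G * tailMatrix x - reversalMatrix x)).det := by
  classical
  rw [headMatrix_mul_tailMatrix_sub_reversalMatrix]
  let s : G.Dart → ℝ := fun d => Real.sqrt (x (dartEdge d))
  let B : Matrix G.Dart G.Dart ℝ := Matrix.of fun d d' => if Step d d' then 1 else 0
  have h1 : stepMatrix x = Matrix.diagonal s * (B * Matrix.diagonal s) := by
    ext d d'
    simp only [Matrix.diagonal_mul, Matrix.mul_diagonal, stepMatrix, B, Matrix.of_apply, s]
    split_ifs
    · rw [one_mul, ← Real.sqrt_mul (hx _)]; rfl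
    · simp
  have h2 : (Matrix.of fun d d' : G.Dart => if Step d d' then x (dartEdge d') else 0) =
      B * Matrix.diagonal s * Matrix.diagonal s := by
    ext d d'
    simp only [Matrix.mul_diagonal, B, Matrix.of_apply, s]
    split_ifs
    · rw [one_mul, Real.mul_self_sqrt (hx _)]
    · simp
  rw [h1, h2, Matrix.det_one_sub_mul_comm]

/-- The weighted **Ihara–Bass formula**. -/
theorem det_one_sub_stepMatrix_eq (x : G.edgeSet → ℝ) (hx : ∀ e, 0 ≤ x e) (hx1 : ∀ e, x e < 1) :
    (1 - stepMatrix x).det =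
      (∏ e : G.edgeSet, (1 - x e ^ 2)) *
        (laplacian (fun e => x e / (1 - x e ^ 2)) (lamStar x)).det := by
  have hne : ∀ e, 1 - x e ^ 2 ≠ 0 := fun e => by
    have := hx e; have := hx1 e; nlinarith
  let K := reversalMatrix x
  let Z : Matrix G.Dart G.Dart ℝ := Matrix.diagonal fun d => (1 - x (dartEdge d) ^ 2)⁻¹
  -- `N` is the inverse of `1 + K`, as `K * K` is diagonal with entries `x²` and `Z` inverts `1 - K
  -- * K`.
  let N : Matrix G.Dart G.Dart ℝ := (1 - K) * Z
  have hN : (1 + K) * N = 1 := by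
    have h1 : (1 + K) * N = (1 - K * K) * Z := by
      simp only [N, ← Matrix.mul_assoc]; congr 1; noncomm_ring
    rw [h1, reversalMatrix_mul_self, ← Matrix.diagonal_one, Matrix.diagonal_sub,
      Matrix.diagonal_mul_diagonal]
    congr 1
    funext d
    exact mul_inv_cancel₀ (hne _)
  have h2 : 1 - (headMatrix G * tailMatrix x - K) =
      (1 + K) * (1 - N * headMatrix G * tailMatrix x) := by
    rw [Matrix.mul_sub, Matrix.mul_one, ← Matrix.mul_assoc, ← Matrix.mul_assoc, hN,
      Matrix.one_mul]
    abel
  -- Swapping the factors of the remaining product replaces a determinant over directed edges by one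
  -- over vertices. It then remains to identify `1 - tailMatrix x * (N * headMatrix G)` with the
  -- Laplacian: `h3` gives the off-diagonal conductances and `h4` the diagonal.
  rw [det_one_sub_stepMatrix x hx, h2, Matrix.det_mul, det_one_add_reversalMatrix,
    Matrix.det_one_sub_mul_comm]
  congr 2
  have hNH : ∀ d u, (N * headMatrix G) d u =
      (if d.snd = u then (1 - x (dartEdge d) ^ 2)⁻¹ else 0) -
        if d.fst = u then x (dartEdge d) * (1 - x (dartEdge d) ^ 2)⁻¹ else 0 := by
    intro d u
    simp only [N, Matrix.sub_mul, Matrix.one_mul, Matrix.sub_apply, Matrix.mul_assoc, Z,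
      Matrix.diagonal_mul, headMatrix, Matrix.mul_apply (M := K), K, reversalMatrix, ite_mul,
      zero_mul, Finset.sum_ite_eq', Finset.mem_univ, if_true, dartEdge_symm]
    simp only [mul_ite, mul_one, mul_zero]
    rfl
  ext v u
  simp only [Matrix.sub_apply, Matrix.mul_apply (N := N * headMatrix G), hNH, tailMatrix,
    laplacian, Matrix.of_apply, ite_mul, zero_mul, mul_sub, ← Finset.sum_filter,
    Finset.sum_sub_distrib]
  have h3 : (∑ d : G.Dart with d.fst = v,
      x (dartEdge d) * if d.snd = u then (1 - x (dartEdge d) ^ 2)⁻¹ else 0) =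
      if h : G.Adj v u then x ⟨s(v, u), h⟩ / (1 - x ⟨s(v, u), h⟩ ^ 2) else 0 := by
    have h := sum_dart_eq_sum_sum (G := G) (fun e => x e / (1 - x e ^ 2))
      fun a b => if b = u then if a = v then 1 else 0 else 0
    simp only [mul_ite, mul_one, mul_zero, Finset.sum_ite_eq', Finset.mem_univ, if_true] at h
    rw [Finset.sum_filter]
    refine Eq.trans (Finset.sum_congr rfl fun d _ => ?_) h
    simp only [mul_ite, mul_zero, div_eq_mul_inv]
    split_ifs <;> rfl
  have h4 : (∑ d : G.Dart with d.fst = v,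
      x (dartEdge d) * if d.fst = u then x (dartEdge d) * (1 - x (dartEdge d) ^ 2)⁻¹ else 0) =
      if v = u then lamStar x v - 1 else 0 := by
    have h5 : ∀ d ∈ Finset.univ.filter (fun d : G.Dart => d.fst = v),
        (x (dartEdge d) * if d.fst = u then x (dartEdge d) * (1 - x (dartEdge d) ^ 2)⁻¹ else 0) =
        (fun e => if v = u then x e ^ 2 / (1 - x e ^ 2) else 0) (dartEdge d) := by
      intro d hd
      rw [Finset.mem_filter_univ] at hd
      rw [hd]
      simp only [mul_ite, mul_zero, div_eq_mul_inv, sq, mul_assoc]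
    rw [Finset.sum_congr rfl h5,
      sum_dart_fst fun e => if v = u then x e ^ 2 / (1 - x e ^ 2) else 0, lamStar]
    split_ifs <;> simp
  rw [h3, h4, Matrix.one_apply, Matrix.diagonal_apply]
  split_ifs <;> ring

end IharaBass


/-! ### Gaussian integrals. -/

section Gaussian

open Matrix MeasureTheory
open scoped MatrixOrder Matrix.Norms.L2Operator

variable {V : Type*} [Fintype V] [DecidableEq V]

theorem lintegral_exp_neg_half_dotProduct_self :
    ∫⁻ φ : V → ℝ, ENNReal.ofReal (Real.exp (-(1 / 2 * (φ ⬝ᵥ φ)))) =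
      ENNReal.ofReal ((2 * Real.pi) ^ ((Fintype.card V : ℝ) / 2)) := by
  have h : ∀ φ : V → ℝ, Real.exp (-(1 / 2 * (φ ⬝ᵥ φ))) =
      ∏ v, Real.exp (-(1 / 2) * φ v ^ 2) := by
    intro φ
    rw [← Real.exp_sum, dotProduct, ← Finset.mul_sum]
    simp only [sq, neg_mul]
  simp only [h]
  have hint : Integrable fun φ : V → ℝ => ∏ v, Real.exp (-(1 / 2) * φ v ^ 2) :=
    Integrable.fintype_prod fun _ => integrable_exp_neg_mul_sq (by norm_num)
  rw [← ofReal_integral_eq_lintegral_ofReal hint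
    (Filter.Eventually.of_forall fun φ => Finset.prod_nonneg fun _ _ => (Real.exp_pos _).le),
    integral_fintype_prod_volume_eq_pow fun t : ℝ => Real.exp (-(1 / 2) * t ^ 2),
    integral_gaussian]
  congr 1
  rw [show Real.pi / (1 / 2) = 2 * Real.pi by ring, Real.sqrt_eq_rpow, ← Real.rpow_natCast,
    ← Real.rpow_mul (by positivity)]
  congr 1
  ring

/-- The Gaussian integral of a nondegenerate positive semidefinite quadratic form. -/
theorem lintegral_exp_neg_half_quadratic {M : Matrix V V ℝ} (hM : M.PosSemidef)
    (hdet : M.det ≠ 0) :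
    ∫⁻ φ : V → ℝ, ENNReal.ofReal (Real.exp (-(1 / 2 * (φ ⬝ᵥ (M *ᵥ φ))))) =
      ENNReal.ofReal ((2 * Real.pi) ^ ((Fintype.card V : ℝ) / 2) * M.det ^ (-(1 / 2) : ℝ)) := by
  -- With `M = Bᵀ B`, the substitution `y = B φ` gives the standard Gaussian, with Jacobian factor
  -- `|det B|⁻¹ = (det M)^(-1/2)`.
  obtain ⟨B, hB⟩ := CStarAlgebra.nonneg_iff_eq_star_mul_self.mp hM.nonneg
  rw [star_eq_conjTranspose, conjTranspose_eq_transpose_of_trivial] at hB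
  have hdetB : M.det = B.det ^ 2 := by rw [hB, det_mul, det_transpose, sq]
  have hB0 : B.det ≠ 0 := fun h => hdet (by rw [hdetB, h]; simp)
  have hq : ∀ φ : V → ℝ, φ ⬝ᵥ (M *ᵥ φ) = toLin' B φ ⬝ᵥ toLin' B φ := by
    intro φ
    rw [toLin'_apply, hB, ← mulVec_mulVec, dotProduct_mulVec, vecMul_transpose]
  have hmeas : Measurable (toLin' B) := (toLin' B).continuous_of_finiteDimensional.measurable
  have hg : Measurable fun y : V → ℝ => ENNReal.ofReal (Real.exp (-(1 / 2 * (y ⬝ᵥ y)))) := by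
    unfold dotProduct
    fun_prop
  simp only [hq]
  rw [← lintegral_map hg hmeas, Real.map_matrix_volume_pi_eq_smul_volume_pi hB0,
    lintegral_smul_measure, lintegral_exp_neg_half_dotProduct_self, smul_eq_mul,
    ← ENNReal.ofReal_mul (abs_nonneg _), mul_comm, hdetB]
  congr 2
  rw [Real.rpow_neg (sq_nonneg _), ← Real.sqrt_eq_rpow, Real.sqrt_sq_eq_abs, abs_inv]

end Gaussian

/-! ### The free field Hamiltonian as a Laplacian form. -/

section Networks

open Matrix SimpleGraph

variable {V : Type*} {G : SimpleGraph V} [Fintype V] [DecidableEq V] [DecidableRel G.Adj]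

theorem sum_dite_adj (c : G.edgeSet → ℝ) (v : V) :
    ∑ u, (if h : G.Adj v u then c ⟨s(v, u), h⟩ else 0) = ∑ e : G.edgeSet with v ∈ e.1, c e := by
  have h := sum_dart_eq_sum_sum c fun a _ => if a = v then 1 else 0
  rw [← sum_dart_fst, Finset.sum_filter]
  simp only [mul_ite, mul_one, mul_zero] at h
  rw [h, Finset.sum_comm]
  simp

theorem sum_dart_eq_two_mul_sum (g : G.edgeSet → ℝ) :
    ∑ d : G.Dart, g (dartEdge d) = 2 * ∑ e, g e := by
  rw [← (edgeSumEquivDart G).sum_comp, Fintype.sum_sum_type]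
  simp only [dartEdge_edgeSumEquivDart_inl, dartEdge_edgeSumEquivDart_inr]
  ring

theorem sum_dart_mul_fst (c : G.edgeSet → ℝ) (f : V → ℝ) :
    ∑ d : G.Dart, c (dartEdge d) * f d.fst =
      ∑ v, (∑ e : G.edgeSet with v ∈ e.1, c e) * f v := by
  rw [← Finset.sum_fiberwise Finset.univ fun d : G.Dart => d.fst]
  refine Finset.sum_congr rfl fun v _ => ?_
  rw [← sum_dart_fst, Finset.sum_mul]
  refine Finset.sum_congr rfl fun d hd => ?_
  rw [Finset.mem_filter_univ] at hd
  rw [hd]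

theorem dotProduct_laplacian (c : G.edgeSet → ℝ) (r φ : V → ℝ) :
    φ ⬝ᵥ (laplacian c r *ᵥ φ) =
      ∑ v, r v * φ v ^ 2 - ∑ d : G.Dart, c (dartEdge d) * (φ d.fst * φ d.snd) := by
  rw [sum_dart_eq_sum_sum c fun a b => φ a * φ b, laplacian, Matrix.sub_mulVec, dotProduct_sub]
  congr 1
  · simp only [dotProduct, mulVec_diagonal]
    exact Finset.sum_congr rfl fun v _ => by ring
  · simp only [dotProduct, mulVec, Finset.mul_sum, Matrix.of_apply]
    exact Finset.sum_congr rfl fun v _ => Finset.sum_congr rfl fun u _ => by ring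

/-- Counting each edge in both directions and expanding the squares, reversal symmetry merges the
two square terms; together with the killing they give the total rate on the diagonal. -/
theorem KilledNetwork.hamiltonian_eq (N : KilledNetwork G) (φ : V → ℝ) :
    N.hamiltonian φ = 1 / 2 * (φ ⬝ᵥ (laplacian N.conductance N.rate *ᵥ φ)) := by
  let q : G.edgeSet → ℝ := fun e => N.conductance e *
    Sym2.lift ⟨fun v u => (φ v - φ u) ^ 2, fun v u => by ring⟩ e.1
  have h1 := sum_dart_eq_two_mul_sum q
  have h2 : ∀ d : G.Dart, q (dartEdge d) =
      N.conductance (dartEdge d) * φ d.fst ^ 2 + N.conductance (dartEdge d) * φ d.snd ^ 2 -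
        2 * (N.conductance (dartEdge d) * (φ d.fst * φ d.snd)) := by
    intro d
    change N.conductance (dartEdge d) * (φ d.fst - φ d.snd) ^ 2 = _
    ring
  have h3 : ∑ d : G.Dart, N.conductance (dartEdge d) * φ d.snd ^ 2 =
      ∑ d : G.Dart, N.conductance (dartEdge d) * φ d.fst ^ 2 := by
    rw [← Equiv.sum_comp (Function.Involutive.toPerm _ (Dart.symm_involutive (G := G)))]
    refine Finset.sum_congr rfl fun d _ => ?_
    change N.conductance (dartEdge d.symm) * φ d.fst ^ 2 = _
    rw [dartEdge_symm]
  simp only [h2, Finset.sum_sub_distrib, Finset.sum_add_distrib, h3, ← Finset.mul_sum] at h1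
  rw [sum_dart_mul_fst N.conductance fun v => φ v ^ 2] at h1
  have h4 : N.hamiltonian φ = 1 / 2 * ∑ e, q e + 1 / 2 * ∑ v, N.killing v * φ v ^ 2 := rfl
  rw [h4, dotProduct_laplacian]
  simp only [KilledNetwork.rate, add_mul, Finset.sum_add_distrib]
  linarith

theorem KilledNetwork.hamiltonian_nonneg (N : KilledNetwork G) (φ : V → ℝ) :
    0 ≤ N.hamiltonian φ := by
  refine add_nonneg (mul_nonneg (by norm_num) (Finset.sum_nonneg fun e _ =>
    mul_nonneg (N.conductance_nonneg e) ?_)) (mul_nonneg (by norm_num)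
      (Finset.sum_nonneg fun v _ => mul_nonneg (N.killing_nonneg v) (sq_nonneg _)))
  obtain ⟨d, rfl⟩ := exists_dartEdge_eq e
  exact sq_nonneg (φ d.fst - φ d.snd)

theorem KilledNetwork.posSemidef_laplacian (N : KilledNetwork G) :
    (laplacian N.conductance N.rate).PosSemidef := by
  refine Matrix.PosSemidef.of_dotProduct_mulVec_nonneg ?_ fun φ => ?_
  · ext v u
    simp only [conjTranspose_apply, laplacian, Matrix.sub_apply, Matrix.of_apply, diagonal_apply,
      star_trivial, G.adj_comm u v]
    congr 1
    · by_cases h : v = u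
      · subst h; rfl
      · rw [if_neg h, if_neg (Ne.symm h)]
    · split_ifs
      · congr 2; exact Sym2.eq_swap
      · rfl
  · have h := N.hamiltonian_nonneg φ
    rw [N.hamiltonian_eq] at h
    rw [star_trivial]
    linarith

theorem KilledNetwork.gffPartition_eq (N : KilledNetwork G)
    (hdet : (laplacian N.conductance N.rate).det ≠ 0) :
    N.gffPartition = ENNReal.ofReal ((2 * Real.pi) ^ ((Fintype.card V : ℝ) / 2) *
      (laplacian N.conductance N.rate).det ^ (-(1 / 2) : ℝ)) := by
  rw [← lintegral_exp_neg_half_quadratic N.posSemidef_laplacian hdet, gffPartition]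
  simp only [N.hamiltonian_eq]

end Networks

/-! ### Finiteness of Green's function. -/

section Green

variable {V : Type*} [Fintype V] [DecidableEq V]

/-- The chain never returns from the cemetery, so paths between points of `V` stay in `V`. -/
theorem markovExtension_pow (P : Matrix V V ℝ) (n : ℕ) (v u : V) :
    (markovExtension P ^ n) (some v) (some u) = (P ^ n) v u := by
  induction n generalizing u with
  | zero => simp [Matrix.one_apply]
  | succ n ih =>
    rw [pow_succ, pow_succ, Matrix.mul_apply, Matrix.mul_apply, Fintype.sum_option]
    simp [ih, markovExtension]

theorem IsSubMarkovian.pow {P : Matrix V V ℝ} (hP : IsSubMarkovian P) (n : ℕ) :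
    IsSubMarkovian (P ^ n) := by
  induction n with
  | zero =>
    refine ⟨fun v u => ?_, fun v => ?_⟩
    · rw [pow_zero, Matrix.one_apply]; split_ifs <;> simp
    · simp [Matrix.one_apply]
  | succ n ih =>
    rw [pow_succ]
    refine ⟨fun v u => Finset.sum_nonneg fun w _ => mul_nonneg (ih.1 v w) (hP.1 w u),
      fun v => ?_⟩
    simp only [Matrix.mul_apply]
    rw [Finset.sum_comm]
    calc ∑ w, ∑ u, (P ^ n) v w * P w u = ∑ w, (P ^ n) v w * ∑ u, P w u := by
          simp only [Finset.mul_sum]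
      _ ≤ ∑ w, (P ^ n) v w := Finset.sum_le_sum fun w _ =>
          mul_le_of_le_one_right (ih.1 v w) (hP.2 w)
      _ ≤ 1 := ih.2 v

theorem IsSubMarkovian.le_one {P : Matrix V V ℝ} (hP : IsSubMarkovian P) (v u : V) :
    P v u ≤ 1 :=
  (Finset.single_le_sum (fun w _ => hP.1 v w) (Finset.mem_univ u)).trans (hP.2 v)

/-- The partial sums equal `(1 - P)⁻¹ (1 - P ^ n)`, and the entries of `1 - P ^ n` lie in `[-1, 1]`,
which bounds them uniformly in `n`. -/
theorem green_markovExtension_lt_top {P : Matrix V V ℝ} (hP : IsSubMarkovian P)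
    (hdet : (1 - P).det ≠ 0) (v u : V) : green (markovExtension P) v u < ⊤ := by
  unfold green
  simp only [markovExtension_pow]
  have hunit : IsUnit (1 - P).det := isUnit_iff_ne_zero.2 hdet
  refine lt_of_le_of_lt (ENNReal.tsum_le_of_sum_range_le
    (c := ENNReal.ofReal (∑ w, |(1 - P)⁻¹ v w|)) fun n => ?_) ENNReal.ofReal_lt_top
  rw [← ENNReal.ofReal_sum_of_nonneg fun k _ => (hP.pow k).1 v u]
  refine ENNReal.ofReal_le_ofReal ?_
  have h : ∑ k ∈ Finset.range n, P ^ k = (1 - P)⁻¹ * (1 - P ^ n) := by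
    rw [← mul_neg_geom_sum P n, Matrix.nonsing_inv_mul_cancel_left _ _ hunit]
  rw [← Matrix.sum_apply, h, Matrix.mul_apply]
  refine Finset.sum_le_sum fun w _ => ?_
  refine (le_abs_self _).trans ?_
  rw [abs_mul]
  refine mul_le_of_le_one_right (abs_nonneg _) ?_
  have h0 := (hP.pow n).1 w u
  have h1 := (hP.pow n).le_one w u
  rw [Matrix.sub_apply, Matrix.one_apply, abs_le]
  split_ifs <;> constructor <;> linarith

end Green


/-! ### The loop partition function as a determinant. -/

section LoopPartition

open scoped NNReal

variable {V : Type*} {G : SimpleGraph V}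

theorem loopPartition_eq_tsum_multisetWeight [DecidableEq (Loop G)] (x : G.edgeSet → ℝ) :
    loopPartition x = ∑' L : Multiset (Loop G),
      (multisetWeight (fun ℓ => (loopMeasure x ℓ).toNNReal) L : ℝ≥0∞) := by
  unfold loopPartition
  refine tsum_congr fun L => ?_
  rw [← ENNReal.ofReal_coe_nnreal]
  congr 1
  unfold configWeight multisetWeight
  push_cast
  simp only [Real.coe_toNNReal _ (loopMeasure_nonneg x _)]
  congr!

/-- The partition function of the loop soup when it is finite. -/
theorem loopPartition_eq_exp (x : G.edgeSet → ℝ) (hZ : loopPartition x < ⊤) :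
    ∑' ℓ : Loop G, ENNReal.ofReal (loopMeasure x ℓ) ≠ ⊤ ∧
      loopPartition x =
        ENNReal.ofReal (Real.exp (∑' ℓ : Loop G, ENNReal.ofReal (loopMeasure x ℓ)).toReal) := by
  classical
  let a : Loop G → ℝ≥0 := fun ℓ => (loopMeasure x ℓ).toNNReal
  have ha : ∀ ℓ, (a ℓ : ℝ≥0∞) = ENNReal.ofReal (loopMeasure x ℓ) :=
    fun _ => rfl
  have h : ∑' ℓ : Loop G, ENNReal.ofReal (loopMeasure x ℓ) ≠ ⊤ := by
    rw [loopPartition_eq_tsum_multisetWeight] at hZ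
    have := (tsum_le_tsum_multisetWeight a).trans_lt hZ
    rw [tsum_congr ha] at this
    exact this.ne
  refine ⟨h, ?_⟩
  rw [loopPartition_eq_tsum_multisetWeight, ← tsum_congr ha]
  exact tsum_multisetWeight_eq_exp a (by rwa [tsum_congr ha])

theorem trace_stepMatrix_pow_div_nonneg [Fintype G.Dart] [DecidableEq G.Dart]
    (x : G.edgeSet → ℝ) (n : ℕ) : 0 ≤ (stepMatrix x ^ n).trace / n := by
  rcases n with _ | n
  · simp
  · rw [trace_pow_succ_eq_sum_zmod]
    exact div_nonneg (Finset.sum_nonneg fun f _ => Finset.prod_nonneg fun i _ =>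
      stepMatrix_nonneg x _ _) (Nat.cast_nonneg _)

/-- A finite loop partition function is the determinant of `1 - Λ` to the power `-1/2`. -/
theorem loopPartition_eq_det [Fintype G.Dart] [DecidableEq G.Dart] (x : G.edgeSet → ℝ)
    (hZ : loopPartition x < ⊤) :
    0 < (1 - stepMatrix x).det ∧
      loopPartition x = ENNReal.ofReal ((1 - stepMatrix x).det ^ (-(1 / 2) : ℝ)) := by
  obtain ⟨hfin, hZ⟩ := loopPartition_eq_exp x hZ
  rw [tsum_loopMeasure_eq_tsum_trace] at hfin hZ
  have h0 : ∀ n : ℕ, 0 ≤ 2⁻¹ * ((stepMatrix x ^ n).trace / n) :=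
    fun n => mul_nonneg (by norm_num) (trace_stepMatrix_pow_div_nonneg x n)
  -- The terms are nonnegative, so finite loop mass is exactly the absolute convergence that the
  -- determinant formula requires.
  have hsum : Summable fun n : ℕ => (stepMatrix x ^ n).trace / n := by
    have := ENNReal.summable_toReal hfin
    simp only [ENNReal.toReal_ofReal (h0 _)] at this
    exact (summable_mul_left_iff (by norm_num)).1 this
  have hdet := det_one_sub_eq_exp_neg_tsum_trace_real (stepMatrix x) hsum.norm
  refine ⟨hdet ▸ Real.exp_pos _, ?_⟩
  rw [hZ, hdet, ← Real.exp_mul, ← ENNReal.ofReal_tsum_of_nonneg h0 (hsum.mul_left _),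
    ENNReal.toReal_ofReal (tsum_nonneg h0), tsum_mul_left]
  congr 2
  ring

end LoopPartition

/-! ### The network behind `P*`. -/

section StarNetwork

open Matrix

variable {V : Type*} {G : SimpleGraph V} [Fintype V] [DecidableEq V] [DecidableRel G.Adj]

theorem lamStar_pos {x : G.edgeSet → ℝ} (h0 : ∀ e, 0 < x e) (h1 : ∀ e, x e < 1) (v : V) :
    0 < lamStar x v := by
  refine add_pos_of_pos_of_nonneg one_pos (Finset.sum_nonneg fun e _ => ?_)
  have := h0 e
  have := h1 e
  exact div_nonneg (sq_nonneg _) (by nlinarith)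

/-- Edge by edge, `x²/(1 - x²) - x/(1 - x²) = -x/(1 + x)`. The left side is the killing rate, so the
vertex condition says precisely that killing is nonnegative. -/
theorem lamStar_sub_sum_conductance {x : G.edgeSet → ℝ} (h0 : ∀ e, 0 < x e) (h1 : ∀ e, x e < 1)
    (v : V) : lamStar x v - ∑ e : G.edgeSet with v ∈ e.1, x e / (1 - x e ^ 2) =
      1 - ∑ e : G.edgeSet with v ∈ e.1, x e / (1 + x e) := by
  rw [lamStar, add_sub_assoc, ← Finset.sum_sub_distrib, sub_eq_add_neg, ← Finset.sum_neg_distrib]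
  congr 1
  refine Finset.sum_congr rfl fun e _ => ?_
  have h2 : 1 + x e ≠ 0 := by have := h0 e; positivity
  have h3 : 1 - x e ≠ 0 := by have := h1 e; linarith
  rw [show 1 - x e ^ 2 = (1 + x e) * (1 - x e) by ring]
  field_simp
  ring

/-- The network with conductances `x / (1 - x²)` and total rates `λ*`. -/
def starNetwork (x : G.edgeSet → ℝ) (h0 : ∀ e, 0 < x e) (h1 : ∀ e, x e < 1)
    (hvertex : ∀ v : V, ∑ e : G.edgeSet with v ∈ e.1, x e / (1 + x e) ≤ 1) :
    KilledNetwork G where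
  conductance e := x e / (1 - x e ^ 2)
  killing v := lamStar x v - ∑ e : G.edgeSet with v ∈ e.1, x e / (1 - x e ^ 2)
  conductance_nonneg e := by
    have := h0 e
    have := h1 e
    exact div_nonneg (h0 e).le (by nlinarith)
  killing_nonneg v := by
    rw [lamStar_sub_sum_conductance h0 h1]
    linarith [hvertex v]

theorem sum_PStar (x : G.edgeSet → ℝ) (v : V) :
    ∑ u, PStar x v u = (∑ e : G.edgeSet with v ∈ e.1, x e / (1 - x e ^ 2)) / lamStar x v := by
  rw [← sum_dite_adj, Finset.sum_div]
  refine Finset.sum_congr rfl fun u _ => ?_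
  unfold PStar
  split_ifs
  · ring
  · simp

theorem isSubMarkovian_PStar {x : G.edgeSet → ℝ} (h0 : ∀ e, 0 < x e) (h1 : ∀ e, x e < 1)
    (hvertex : ∀ v : V, ∑ e : G.edgeSet with v ∈ e.1, x e / (1 + x e) ≤ 1) :
    IsSubMarkovian (PStar x) := by
  refine ⟨fun v u => ?_, fun v => ?_⟩
  · unfold PStar
    split_ifs with h
    · exact mul_nonneg (one_div_nonneg.2 (lamStar_pos h0 h1 v).le)
        ((starNetwork x h0 h1 hvertex).conductance_nonneg _)
    · exact le_rfl
  · rw [sum_PStar, div_le_one (lamStar_pos h0 h1 v)]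
    linarith [(starNetwork x h0 h1 hvertex).killing_nonneg v,
      show (starNetwork x h0 h1 hvertex).killing v = lamStar x v -
        ∑ e : G.edgeSet with v ∈ e.1, x e / (1 - x e ^ 2) from rfl]

theorem isSymmetricWrt_PStar {x : G.edgeSet → ℝ} (h0 : ∀ e, 0 < x e) (h1 : ∀ e, x e < 1) :
    IsSymmetricWrt (lamStar x) (PStar x) := by
  intro v u
  have hv := (lamStar_pos h0 h1 v).ne'
  have hu := (lamStar_pos h0 h1 u).ne'
  unfold PStar
  by_cases h : G.Adj v u
  · rw [dif_pos h, dif_pos h.symm]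
    have he : (⟨s(v, u), h⟩ : G.edgeSet) = ⟨s(u, v), h.symm⟩ := Subtype.ext Sym2.eq_swap
    rw [he]
    field_simp
  · rw [dif_neg h, dif_neg fun h' => h h'.symm, mul_zero, mul_zero]

theorem starNetwork_rate {x : G.edgeSet → ℝ} (h0 : ∀ e, 0 < x e) (h1 : ∀ e, x e < 1)
    (hvertex : ∀ v : V, ∑ e : G.edgeSet with v ∈ e.1, x e / (1 + x e) ≤ 1) :
    (starNetwork x h0 h1 hvertex).rate = lamStar x := by
  funext v
  simp [KilledNetwork.rate, starNetwork]

theorem starNetwork_transition {x : G.edgeSet → ℝ} (h0 : ∀ e, 0 < x e) (h1 : ∀ e, x e < 1)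
    (hvertex : ∀ v : V, ∑ e : G.edgeSet with v ∈ e.1, x e / (1 + x e) ≤ 1) :
    (starNetwork x h0 h1 hvertex).transition = markovExtension (PStar x) := by
  ext (_ | v) (_ | u)
  · rfl
  · rfl
  · simp only [KilledNetwork.transition, markovExtension, starNetwork_rate, sum_PStar]
    have hv := (lamStar_pos h0 h1 v).ne'
    simp only [starNetwork]
    field_simp
  · simp only [KilledNetwork.transition, markovExtension, starNetwork_rate, PStar]
    split_ifs
    · simp only [starNetwork]
      ring
    · rfl

/-- Once the rates are prescribed, the transition probability along an edge determines its
conductance. The killing is then what remains of the rate, whence uniqueness. -/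
theorem conductance_eq_of_transition {x : G.edgeSet → ℝ} (h0 : ∀ e, 0 < x e)
    (h1 : ∀ e, x e < 1) {N : KilledNetwork G} (hr : N.rate = lamStar x)
    (ht : N.transition = markovExtension (PStar x)) :
    N.conductance = fun e => x e / (1 - x e ^ 2) := by
  funext e
  obtain ⟨d, rfl⟩ := exists_dartEdge_eq e
  have h := congrFun (congrFun ht (some d.fst)) (some d.snd)
  have hl := (lamStar_pos h0 h1 d.fst).ne'
  simp only [KilledNetwork.transition, markovExtension, PStar, hr, dif_pos d.adj] at h
  change N.conductance (dartEdge d) / _ = 1 / _ * (x (dartEdge d) / (1 - x (dartEdge d) ^ 2)) at h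
  rw [one_div, inv_mul_eq_div] at h
  exact (div_left_inj' hl).1 h

theorem existsUnique_network {x : G.edgeSet → ℝ} (h0 : ∀ e, 0 < x e) (h1 : ∀ e, x e < 1)
    (hvertex : ∀ v : V, ∑ e : G.edgeSet with v ∈ e.1, x e / (1 + x e) ≤ 1) :
    ∃! N : KilledNetwork G,
      N.rate = lamStar x ∧ N.transition = markovExtension (PStar x) := by
  refine ⟨starNetwork x h0 h1 hvertex, ⟨starNetwork_rate h0 h1 hvertex,
    starNetwork_transition h0 h1 hvertex⟩, ?_⟩
  rintro N ⟨hr, ht⟩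
  have hc := conductance_eq_of_transition h0 h1 hr ht
  have hk : N.killing = (starNetwork x h0 h1 hvertex).killing := by
    funext v
    have := congrFun hr v
    rw [KilledNetwork.rate, hc] at this
    exact eq_sub_of_add_eq' this
  cases N
  simp only at hc hk
  subst hc hk
  rfl

/-- This carries nonvanishing of the determinant from the Laplacian to `1 - P*`, as needed for
Green's function. -/
theorem laplacian_eq_diagonal_mul {x : G.edgeSet → ℝ} (h0 : ∀ e, 0 < x e) (h1 : ∀ e, x e < 1) :
    laplacian (fun e => x e / (1 - x e ^ 2)) (lamStar x) =
      Matrix.diagonal (lamStar x) * (1 - PStar x) := by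
  rw [Matrix.mul_sub, Matrix.mul_one, laplacian]
  congr 1
  ext v u
  have hv := (lamStar_pos h0 h1 v).ne'
  rw [Matrix.diagonal_mul, PStar, Matrix.of_apply]
  split_ifs
  · field_simp
  · rw [mul_zero]

end StarNetwork

end NBLoop

end

/-! ### The identity of partition functions. -/

theorem theorem3 {V : Type*} [Fintype V] [DecidableEq V] (G : SimpleGraph V) [DecidableRel G.Adj]
    (hconn : G.Connected) (hdeg : ∀ v, G.degree v ≠ 1)
    (x : G.edgeSet → ℝ) (hpos : ∀ e, 0 < x e) (hx : ‖x‖ < 1)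
    (hvertex : ∀ v : V, ∑ e : G.edgeSet with v ∈ e.1, x e / (1 + x e) ≤ 1) :
    -- `P*` is a `λ*`-symmetric sub-Markovian transition matrix
    NBLoop.IsSymmetricWrt (NBLoop.lamStar x) (NBLoop.PStar x) ∧
    NBLoop.IsSubMarkovian (NBLoop.PStar x) ∧
    -- exactly one network of edge weights and killing rates induces `λ*` and the extension of `P*`
    (∃! N : NBLoop.KilledNetwork G,
      N.rate = NBLoop.lamStar x ∧ N.transition = NBLoop.markovExtension (NBLoop.PStar x)) ∧
    (NBLoop.loopPartition x < ⊤ →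
      -- Green's function is finite, so that the associated free field exists
      (∀ v u : V, NBLoop.green (NBLoop.markovExtension (NBLoop.PStar x)) v u < ⊤) ∧
      -- the identity of partition functions
      ∀ N : NBLoop.KilledNetwork G,
        N.rate = NBLoop.lamStar x → N.transition = NBLoop.markovExtension (NBLoop.PStar x) →
        NBLoop.loopPartition x =
          ENNReal.ofReal ((2 * Real.pi) ^ (-(Fintype.card V : ℝ) / 2) *
            ∏ e : G.edgeSet, (1 - x e ^ 2) ^ (-(1 / 2) : ℝ)) * N.gffPartition) := by
  have hlt : ∀ e, x e < 1 := fun e =>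
    ((le_abs_self _).trans (norm_le_pi_norm x e)).trans_lt hx
  have hsub := NBLoop.isSubMarkovian_PStar hpos hlt hvertex
  refine ⟨NBLoop.isSymmetricWrt_PStar hpos hlt, hsub,
    NBLoop.existsUnique_network hpos hlt hvertex, fun hZ => ?_⟩
  obtain ⟨hdet, hZdet⟩ := NBLoop.loopPartition_eq_det x hZ
  rw [NBLoop.det_one_sub_stepMatrix_eq x (fun e => (hpos e).le) hlt] at hdet hZdet
  have hfac : ∀ e, 0 < 1 - x e ^ 2 := fun e => by
    have := hpos e
    have := hlt e
    nlinarith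
  have hQ : 0 < ∏ e : G.edgeSet, (1 - x e ^ 2) := Finset.prod_pos fun e _ => hfac e
  -- `det (1 - Λ)` is positive as an exponential and the edge product is positive, so the Laplacian
  -- determinant is positive.
  have hL := (mul_pos_iff_of_pos_left hQ).1 hdet
  refine ⟨NBLoop.green_markovExtension_lt_top hsub fun h => hL.ne' ?_, fun N hr ht => ?_⟩
  · rw [NBLoop.laplacian_eq_diagonal_mul hpos hlt, Matrix.det_mul, h, mul_zero]
  · have hN := N.gffPartition_eq
    rw [hr, NBLoop.conductance_eq_of_transition hpos hlt hr ht] at hN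
    have hpi : 0 < 2 * Real.pi := by positivity
    rw [hZdet, hN hL.ne', ← ENNReal.ofReal_mul (mul_nonneg (Real.rpow_nonneg hpi.le _)
      (Finset.prod_nonneg fun e _ => Real.rpow_nonneg (hfac e).le _)),
      Real.finsetProd_rpow _ _ fun e _ => (hfac e).le, Real.mul_rpow hQ.le hL.le]
    congr 1
    have hc : (2 * Real.pi) ^ (-(Fintype.card V : ℝ) / 2) *
        (2 * Real.pi) ^ ((Fintype.card V : ℝ) / 2) = 1 := by
      rw [← Real.rpow_add hpi, neg_div, neg_add_cancel, Real.rpow_zero]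
    linear_combination (-(∏ e : G.edgeSet, (1 - x e ^ 2)) ^ (-(1 / 2) : ℝ) *
      (NBLoop.laplacian (fun e => x e / (1 - x e ^ 2)) (NBLoop.lamStar x)).det ^
        (-(1 / 2) : ℝ)) * hc
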